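/- A subgroup $H$ of a group $G$ is *verbally closed* in $G$ if every equation $w(x,y,\dots)=h$, where $w$ is an element of a free group $F(x,y,\dots)$ and $h\in H$, that is solvable in $G$ is solvable in $H$; it is *algebraically closed* in $G$ if every finite system of equations $w_1=1,\dots,w_m=1$ with $w_i\in H*F(x,y,\dots)$ that is solvable in $G$ is solvable in $H$. A group $H$ is *strongly verbally closed* if it is algebraically closed in every group containing it as a verbally closed subgroup. A subgroup $B$ of a group $A$ is *pure with respect to $n$-th powers* if every element of $B$ that is an $n$-th power in $A$ is an $n$-th power in $B$, and *$p$-pure* ($p$ prime) if it is pure with respect to $p^k$-th powers for all $k\ge 1$. 1. Let $B_n=\langle\sigma_1,\dots,\sigma_{n-1}\mid \sigma_i\sigma_j=\sigma_j\sigma_i\ (|i-j|\ge 2),\ \sigma_i\sigma_{i+1}\sigma_i=\sigma_{i+1}\sigma_i\sigma_{i+1}\rangle$ be the braid group on $n$ strands, and let $\Delta=(\sigma_1\cdots\sigma_{n-1})(\sigma_1\cdots\sigma_{n-2})\cdots(\sigma_1\sigma_2)\,\sigma_1$ be its fundamental braid. If $B_n$ is non-abelian, then $B_n$ is not strongly verbally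 closed. Moreover, in this case the centre of $B_n$ is generated by $\Delta^2$, the group $B_n$ is torsion-free, and its centre is not $2$-pure; more precisely, it is not pure with respect to squares. 2. For every even integer $n\ge 2$, the group $\mathbf{SL}_n(\mathbb Z)$ is not strongly verbally closed. Moreover, let $J$ be the block-diagonal $n\times n$ matrix with all diagonal blocks equal to $\begin{pmatrix}0&1\\-1&0\end{pmatrix}$. Then $J\in\mathbf{SL}_n(\mathbb Z)$, $J^2=-I$, and the centre of $\mathbf{SL}_n(\mathbb Z)$ is generated by $J^2$; this centre is not $2$-pure (more precisely, it is not pure with respect to squares), and the group $\mathbf{PSL}_n(\mathbb Z)=\mathbf{SL}_n(\mathbb Z)/Z(\mathbf{SL}_n(\mathbb Z))$ is nontrivial and is not a direct product of two nontrivial subgroups. -/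

import Mathlib

/-- `H ≤ G` is verbally closed: an equation `w(x, y, …) = h` with `w` a word in finitely many
variables and `h ∈ H` is solvable in `G` if and only if it is solvable in `H`. -/
def IsVerballyClosed {G : Type*} [Group G] (H : Subgroup G) : Prop :=
  ∀ (X : Type) [Finite X] (w : FreeGroup X) (h : H),
    (∃ f : X → G, FreeGroup.lift f w = (h : G)) ↔ (∃ f : X → H, FreeGroup.lift f w = h)

/-- `H ≤ G` is algebraically closed: every finite system of equations `w = 1` with left-hand sides
`w ∈ H * F(X)` (free product) in finitely many variables is solvable in `G` if and only if it is
solvable in `H`. -/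
def IsAlgebraicallyClosed {G : Type*} [Group G] (H : Subgroup G) : Prop :=
  ∀ (X : Type) [Finite X] (S : Set (Monoid.Coprod H (FreeGroup X))), S.Finite →
    ((∃ f : X → G, ∀ w ∈ S, Monoid.Coprod.lift H.subtype (FreeGroup.lift f) w = 1) ↔
      (∃ f : X → H, ∀ w ∈ S, Monoid.Coprod.lift (MonoidHom.id H) (FreeGroup.lift f) w = 1))

/-- `H` is strongly verbally closed: it is algebraically closed in every group that contains it
(via an embedding `φ`) as a verbally closed subgroup. -/
def IsStronglyVerballyClosed.{u} (H : Type u) [Group H] : Prop :=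
  ∀ (G : Type u) [Group G] (φ : H →* G), Function.Injective φ →
    IsVerballyClosed φ.range → IsAlgebraicallyClosed φ.range

/-- `B ≤ A` is pure with respect to `n`th powers: an element of `B` is an `n`th power in `A` if and
only if it is an `n`th power in `B`. -/
def IsPureForPower {A : Type*} [Group A] (n : ℕ) (B : Subgroup A) : Prop :=
  ∀ b ∈ B, (∃ a : A, a ^ n = b) ↔ (∃ c ∈ B, c ^ n = b)

/-- `B ≤ A` is `p`-pure: pure with respect to `p ^ k`th powers for all positive `k`. -/
def IsPrimePure {A : Type*} [Group A] (p : ℕ) (B : Subgroup A) : Prop :=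
  ∀ k : ℕ, 0 < k → IsPureForPower (p ^ k) B

/-- A nontrivial group that is not the internal direct product of two nontrivial subgroups. -/
def IsDirectlyIndecomposable (G : Type*) [Group G] : Prop :=
  Nontrivial G ∧
    ∀ A B : Subgroup G, A.Normal → B.Normal → A ⊓ B = ⊥ → A ⊔ B = ⊤ → A = ⊥ ∨ B = ⊥

/-- The Artin relators on the letters `σ₀, …, σ_{n-2}`: `σᵢ σⱼ = σⱼ σᵢ` for `|i - j| ≥ 2` and
`σᵢ σⱼ σᵢ = σⱼ σᵢ σⱼ` for `j = i + 1`. -/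
def braidRelators (n : ℕ) : Set (FreeGroup (Fin (n - 1))) :=
  {r | ∃ i j : Fin (n - 1), (i : ℕ) + 2 ≤ j ∧
      r = FreeGroup.of i * FreeGroup.of j * (FreeGroup.of j * FreeGroup.of i)⁻¹} ∪
  {r | ∃ i j : Fin (n - 1), (i : ℕ) + 1 = j ∧
      r = FreeGroup.of i * FreeGroup.of j * FreeGroup.of i *
        (FreeGroup.of j * FreeGroup.of i * FreeGroup.of j)⁻¹}

/-- The braid group on `n` strands, by the Artin presentation (trivial for `n = 0, 1`). -/
abbrev BraidGroup (n : ℕ) : Type :=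
  PresentedGroup (braidRelators n)

/-- The elementary braids. -/
def BraidGroup.σ {n : ℕ} (i : Fin (n - 1)) : BraidGroup n :=
  PresentedGroup.of i

/-- The fundamental braid (half twist)
`Δ = (σ₀ σ₁ ⋯ σ_{n-2}) (σ₀ σ₁ ⋯ σ_{n-3}) ⋯ (σ₀ σ₁) σ₀`. -/
def BraidGroup.fundamental (n : ℕ) : BraidGroup n :=
  ((List.finRange (n - 1)).reverse.map fun s =>
    (((List.finRange (n - 1)).take ((s : ℕ) + 1)).map BraidGroup.σ).prod).prod

/-- For even `n`, the block-diagonal `n × n` matrix all of whose diagonal blocks are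
`!![0, 1; -1, 0]`. -/
def blockRotation (n : ℕ) : Matrix (Fin n) (Fin n) ℤ :=
  Matrix.of fun i j =>
    if Even (i : ℕ) ∧ (j : ℕ) = i + 1 then 1
    else if Even (j : ℕ) ∧ (i : ℕ) = j + 1 then -1
    else 0

/-! Strong verbal closedness of `H` is refuted by one construction. Take `ζ` central in `H` (`Δ²`,
respectively `-1`) and an even `d`, let `i = (p, q)` run over pairs of residues modulo `d` that are
not both even, and divide the power of `H` over these indices by the central subgroup of families
`(ζ ^ (p a + q b))`. `H` embeds diagonally in the quotient.

The image is verbally closed. A solution of `w = h` in the quotient gives `w(xᵢ) = h ζ ^ (p a + q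
b)` in every coordinate, and a primitive vector orthogonal to `(a, b)` yields an index with `d ∣ p a
+ q b` (`TwistIndex.exists_dvd_form`). For `d = 2` and `ζ² = 1` that coordinate solves the equation;
in the braid group, with `d = deg Δ²`, the remaining twist is absorbed into the variables
(`absorbsTwists_of_hom`).

The image is not algebraically closed. In the quotient the coordinate copies of a tuple commute with
each other, multiply to the diagonal tuple, satisfy its relations, and their copies `ζᵢ` of `ζ`
satisfy `∏ ζᵢ ^ p = ∏ ζᵢ ^ q = 1`. A solution in `H`
(`IsStronglyVerballyClosed.exists_commuting_family`) splits the tuple into commuting families. For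
`SL_n(ℤ)`, only one family is noncentral (`trivial_or_trivial_of_split`), and its `ζᵢ` equals `-1`;
for `B_n`, exactly one family has odd degree, as the underlying permutations show
(`not_odd_of_commute`). Either way that index has `p` and `q` even, which the index set excludes.

The centre and torsion of `B_n` come from Garside theory: the positive monoid is cancellative, has
least common multiples, and embeds in `B_n`, where every element is positive up to a power of the
central `Δ²`. -/

/-! ### Part: the positive braid monoid, Garside's lemma and left cancellation. -/

/-- The defining relations of the positive braid monoid on the letters `0, …, m - 1`. -/
inductive BraidMonoid.Rel (m : ℕ) : FreeMonoid (Fin m) → FreeMonoid (Fin m) → Prop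
  | comm (i j : Fin m) (h : (i : ℕ) + 2 ≤ j) :
      BraidMonoid.Rel m (FreeMonoid.of i * FreeMonoid.of j) (FreeMonoid.of j * FreeMonoid.of i)
  | braid (i j : Fin m) (h : (i : ℕ) + 1 = j) :
      BraidMonoid.Rel m (FreeMonoid.of i * FreeMonoid.of j * FreeMonoid.of i)
        (FreeMonoid.of j * FreeMonoid.of i * FreeMonoid.of j)

/-- The positive braid monoid with `m` generators. -/
abbrev BraidMonoid (m : ℕ) : Type := PresentedMonoid (BraidMonoid.Rel m)

namespace BraidMonoid

variable {m : ℕ}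

/-- The generators of the positive braid monoid. -/
def gen (i : Fin m) : BraidMonoid m := PresentedMonoid.of (BraidMonoid.Rel m) i

/-- Indices of commuting distinct generators. -/
def Far (i j : Fin m) : Prop := (i : ℕ) + 2 ≤ j ∨ (j : ℕ) + 2 ≤ i

/-- Indices of generators satisfying the braid relation. -/
def Adj (i j : Fin m) : Prop := (i : ℕ) + 1 = j ∨ (j : ℕ) + 1 = i

theorem Far.symm {i j : Fin m} (h : Far i j) : Far j i := Or.symm h

theorem Adj.symm {i j : Fin m} (h : Adj i j) : Adj j i := Or.symm h

theorem eq_or_adj_or_far (i j : Fin m) : i = j ∨ Adj i j ∨ Far i j := by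
  simp only [Adj, Far, Fin.ext_iff]; omega

theorem gen_comm {i j : Fin m} (h : Far i j) : gen i * gen j = gen j * gen i := by
  rcases h with h | h
  · exact PresentedMonoid.mk_eq_mk_of_rel (Rel.comm i j h)
  · exact (PresentedMonoid.mk_eq_mk_of_rel (Rel.comm j i h)).symm

theorem gen_braid {i j : Fin m} (h : Adj i j) :
    gen i * gen j * gen i = gen j * gen i * gen j := by
  rcases h with h | h
  · exact PresentedMonoid.mk_eq_mk_of_rel (Rel.braid i j h)
  · exact (PresentedMonoid.mk_eq_mk_of_rel (Rel.braid j i h)).symm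

theorem gen_comm_assoc {i j : Fin m} (h : Far i j) (x : BraidMonoid m) :
    gen i * (gen j * x) = gen j * (gen i * x) := by
  rw [← mul_assoc, gen_comm h, mul_assoc]

theorem gen_braid_assoc {i j : Fin m} (h : Adj i j) (x : BraidMonoid m) :
    gen i * (gen j * (gen i * x)) = gen j * (gen i * (gen j * x)) := by
  simpa only [mul_assoc] using congrArg (· * x) (gen_braid h)

/-- The word length. -/
def len : BraidMonoid m →* Multiplicative ℕ :=
  PresentedMonoid.lift (fun _ => Multiplicative.ofAdd 1) (by
    rintro _ _ (⟨i, j, h⟩ | ⟨i, j, h⟩) <;> simp)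

/-- The word length as a natural number. -/
def length (x : BraidMonoid m) : ℕ := (len x).toAdd

@[simp] theorem length_one : length (1 : BraidMonoid m) = 0 := by simp [length]

@[simp] theorem length_mul (x y : BraidMonoid m) : length (x * y) = length x + length y := by
  simp [length]

@[simp] theorem length_gen (i : Fin m) : length (gen i) = 1 := rfl

theorem eq_one_or_exists_gen_mul (x : BraidMonoid m) : x = 1 ∨ ∃ i y, x = gen i * y := by
  obtain ⟨a, rfl⟩ := PresentedMonoid.surjective_mk x
  induction a using FreeMonoid.casesOn with
  | one => exact Or.inl rfl
  | of_mul i y => exact Or.inr ⟨i, PresentedMonoid.mk _ y, rfl⟩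

theorem length_eq_zero {x : BraidMonoid m} : length x = 0 ↔ x = 1 := by
  refine ⟨fun h => ?_, by rintro rfl; simp⟩
  rcases eq_one_or_exists_gen_mul x with rfl | ⟨i, y, rfl⟩
  · rfl
  · simp at h

/-- The right complement: `gen i * compl i j` is the least common right multiple of `gen i` and
`gen j`. -/
noncomputable def compl (i j : Fin m) : BraidMonoid m :=
  open Classical in if i = j then 1 else if Adj i j then gen j * gen i else gen j

@[simp] theorem compl_self (i : Fin m) : compl i i = 1 := by simp [compl]

theorem compl_of_adj {i j : Fin m} (h : Adj i j) : compl i j = gen j * gen i := by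
  have : i ≠ j := by rintro rfl; simp [Adj] at h
  simp [compl, this, h]

theorem compl_of_far {i j : Fin m} (h : Far i j) : compl i j = gen j := by
  have h1 : i ≠ j := by rintro rfl; simp [Far] at h
  have h2 : ¬ Adj i j := by simp only [Adj, Far] at *; omega
  simp [compl, h1, h2]

theorem gen_mul_compl (i j : Fin m) : gen i * compl i j = gen j * compl j i := by
  rcases eq_or_adj_or_far i j with rfl | h | h
  · rfl
  · rw [compl_of_adj h, compl_of_adj h.symm, ← mul_assoc, gen_braid h, mul_assoc]
  · rw [compl_of_far h, compl_of_far h.symm, gen_comm h]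

/-- `gen i * X` and `gen j * Y` are the same multiple of the least common multiple of `gen i` and
`gen j`. -/
def HeadsMatch (i : Fin m) (X : BraidMonoid m) (j : Fin m) (Y : BraidMonoid m) : Prop :=
  ∃ Z, X = compl i j * Z ∧ Y = compl j i * Z

theorem HeadsMatch.symm {i j : Fin m} {X Y : BraidMonoid m} (h : HeadsMatch i X j Y) :
    HeadsMatch j Y i X := by
  obtain ⟨Z, h1, h2⟩ := h
  exact ⟨Z, h2, h1⟩

theorem headsMatch_self {i : Fin m} {X Y : BraidMonoid m} : HeadsMatch i X i Y ↔ X = Y := by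
  simp [HeadsMatch, eq_comm]

theorem headsMatch_adj {i j : Fin m} (h : Adj i j) {X Y : BraidMonoid m} :
    HeadsMatch i X j Y ↔ ∃ Z, X = gen j * (gen i * Z) ∧ Y = gen i * (gen j * Z) := by
  simp [HeadsMatch, compl_of_adj h, compl_of_adj h.symm, mul_assoc]

theorem headsMatch_far {i j : Fin m} (h : Far i j) {X Y : BraidMonoid m} :
    HeadsMatch i X j Y ↔ ∃ Z, X = gen j * Z ∧ Y = gen i * Z := by
  simp [HeadsMatch, compl_of_far h, compl_of_far h.symm]

/-- Heads match in all equal products of length less than `n`. -/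
def HeadsMatchBelow (m n : ℕ) : Prop :=
  ∀ (i j : Fin m) (X Y : BraidMonoid m), gen i * X = gen j * Y → length X + 1 < n →
    HeadsMatch i X j Y

section Trans

variable {n : ℕ} {i j k : Fin m} {X Y V : BraidMonoid m}

/-- Garside's case analysis: the intermediate product begins with `k`. Comparing its two
factorizations leaves equal products of smaller length, to which `ih` applies again; the common tail
so found is rearranged by the relations among `i`, `j`, `k`. -/
theorem HeadsMatch.trans_of_far_of_far (ih : HeadsMatchBelow m n) (hV : length V + 1 ≤ n)
    (hki : Far k i) (hkj : Far k j) (h1 : HeadsMatch i X k V) (h2 : HeadsMatch k V j Y) :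
    HeadsMatch i X j Y := by
  obtain ⟨Z, rfl, rfl⟩ := (headsMatch_far hki.symm).1 h1
  obtain ⟨Z', hZ, rfl⟩ := (headsMatch_far hkj).1 h2
  simp only [length_mul, length_gen] at hV
  rcases eq_or_adj_or_far i j with rfl | h | h
  · have := headsMatch_self.1 (ih _ _ _ _ hZ (by omega))
    rw [headsMatch_self, this]
  · obtain ⟨T, rfl, rfl⟩ := (headsMatch_adj h).1 (ih _ _ _ _ hZ (by omega))
    rw [headsMatch_adj h]
    exact ⟨gen k * T, by rw [gen_comm_assoc hkj, gen_comm_assoc hki],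
      by rw [gen_comm_assoc hki, gen_comm_assoc hkj]⟩
  · obtain ⟨T, rfl, rfl⟩ := (headsMatch_far h).1 (ih _ _ _ _ hZ (by omega))
    rw [headsMatch_far h]
    exact ⟨gen k * T, by rw [gen_comm_assoc hkj], by rw [gen_comm_assoc hki]⟩

theorem HeadsMatch.trans_of_adj_of_far (ih : HeadsMatchBelow m n) (hV : length V + 1 ≤ n)
    (hki : Adj k i) (hkj : Far k j) (h1 : HeadsMatch i X k V) (h2 : HeadsMatch k V j Y) :
    HeadsMatch i X j Y := by
  obtain ⟨Z, rfl, rfl⟩ := (headsMatch_adj hki.symm).1 h1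
  obtain ⟨Z', hZ, rfl⟩ := (headsMatch_far hkj).1 h2
  simp only [length_mul, length_gen] at hV
  have hij : i ≠ j := by rintro rfl; simp only [Adj, Far] at *; omega
  rcases eq_or_adj_or_far i j with h | h | h
  · exact absurd h hij
  · obtain ⟨T, hT, rfl⟩ := (headsMatch_adj h).1 (ih _ _ _ _ hZ (by simp; omega))
    obtain ⟨U, rfl, hU⟩ := (headsMatch_far hkj).1 (ih _ _ _ _ hT (by omega))
    have hl := congrArg length hT
    simp only [length_mul, length_gen] at hl hV
    obtain ⟨S, rfl, rfl⟩ := (headsMatch_adj hki.symm).1 (ih _ _ _ _ hU (by omega))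
    rw [headsMatch_adj h]
    refine ⟨gen k * (gen i * (gen j * S)), ?_, ?_⟩
    · rw [gen_braid_assoc h, gen_comm_assoc hkj, gen_comm_assoc hkj.symm S, gen_braid_assoc hki]
    · rw [gen_comm_assoc hkj.symm (gen i * S), gen_braid_assoc hki, gen_braid_assoc h,
        gen_comm_assoc hkj]
  · obtain ⟨T, hT, rfl⟩ := (headsMatch_far h).1 (ih _ _ _ _ hZ (by simp; omega))
    obtain ⟨U, rfl, rfl⟩ := (headsMatch_far hkj).1 (ih _ _ _ _ hT (by omega))
    rw [headsMatch_far h]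
    exact ⟨gen k * (gen i * U), by rw [gen_comm_assoc h, gen_comm_assoc hkj],
      by rw [gen_braid_assoc hki]⟩

theorem HeadsMatch.trans_of_adj_of_adj (ih : HeadsMatchBelow m n) (hV : length V + 1 ≤ n)
    (hki : Adj k i) (hkj : Adj k j) (h1 : HeadsMatch i X k V) (h2 : HeadsMatch k V j Y) :
    HeadsMatch i X j Y := by
  obtain ⟨Z, rfl, rfl⟩ := (headsMatch_adj hki.symm).1 h1
  obtain ⟨Z', hZ, rfl⟩ := (headsMatch_adj hkj).1 h2
  simp only [length_mul, length_gen] at hV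
  rcases eq_or_adj_or_far i j with rfl | h | h
  · have h3 := headsMatch_self.1 (ih _ _ _ _ hZ (by simp; omega))
    have h4 := headsMatch_self.1 (ih _ _ _ _ h3 (by omega))
    rw [headsMatch_self, h4]
  -- Three indices on a path are never pairwise adjacent.
  · simp only [Adj] at *; omega
  · obtain ⟨T, hT, hT'⟩ := (headsMatch_far h).1 (ih _ _ _ _ hZ (by simp; omega))
    have hl := congrArg length hT
    have hl' := congrArg length hT'
    simp only [length_mul, length_gen] at hl hl'
    obtain ⟨U, rfl, hU⟩ := (headsMatch_adj hkj).1 (ih _ _ _ _ hT (by omega))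
    obtain ⟨S, rfl, hS⟩ := (headsMatch_adj hki).1 (ih _ _ _ _ hT' (by omega))
    rw [hU] at hS
    simp only [length_mul, length_gen] at hl hV
    have h3 := headsMatch_self.1 (ih _ _ _ _ hS (by simp; omega))
    obtain ⟨R, rfl, rfl⟩ := (headsMatch_far h.symm).1 (ih _ _ _ _ h3 (by omega))
    rw [headsMatch_far h]
    refine ⟨gen k * (gen j * (gen i * (gen k * R))), ?_, ?_⟩
    · rw [gen_comm_assoc h, ← gen_braid_assoc hki, gen_braid_assoc hkj]
    · rw [gen_comm_assoc h.symm, ← gen_braid_assoc hkj, gen_braid_assoc hki,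
        gen_comm_assoc h]

theorem HeadsMatch.trans (ih : HeadsMatchBelow m n) (hV : length V + 1 ≤ n)
    (h1 : HeadsMatch i X k V) (h2 : HeadsMatch k V j Y) : HeadsMatch i X j Y := by
  rcases eq_or_adj_or_far k i with rfl | hki | hki
  · rw [headsMatch_self] at h1; rwa [h1]
  all_goals rcases eq_or_adj_or_far k j with rfl | hkj | hkj
  · rw [headsMatch_self] at h2; rwa [← h2]
  · exact .trans_of_adj_of_adj ih hV hki hkj h1 h2
  · exact .trans_of_adj_of_far ih hV hki hkj h1 h2
  · rw [headsMatch_self] at h2; rwa [← h2]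
  · exact (HeadsMatch.trans_of_adj_of_far ih hV hkj hki h2.symm h1.symm).symm
  · exact .trans_of_far_of_far ih hV hki hkj h1 h2

end Trans

theorem mk_eq_of_rel {u v : FreeMonoid (Fin m)} (h : ConGen.Rel (Rel m) u v) :
    PresentedMonoid.mk (Rel m) u = PresentedMonoid.mk (Rel m) v :=
  PresentedMonoid.mk_eq_mk_iff.2 h

@[simp] theorem mk_of (i : Fin m) : PresentedMonoid.mk (Rel m) (FreeMonoid.of i) = gen i := rfl

/-- Induction on the derivation of the congruence. Only transitivity uses the hypothesis on shorter
products, since the intermediate word may begin with a third letter. -/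
theorem headsMatch_of_conGen {n : ℕ} (ih : HeadsMatchBelow m n) {u v : FreeMonoid (Fin m)}
    (h : ConGen.Rel (Rel m) u v) (hu : length (PresentedMonoid.mk (Rel m) u) ≤ n)
    (i j : Fin m) (X Y : FreeMonoid (Fin m)) (hX : u = FreeMonoid.of i * X)
    (hY : v = FreeMonoid.of j * Y) :
    HeadsMatch i (PresentedMonoid.mk _ X) j (PresentedMonoid.mk _ Y) := by
  induction h generalizing i j X Y with
  | of u v h =>
    rcases h with ⟨i', j', h⟩ | ⟨i', j', h⟩
    · obtain ⟨rfl, rfl⟩ := List.cons.inj hX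
      obtain ⟨rfl, rfl⟩ := List.cons.inj hY
      exact (headsMatch_far (Or.inl h)).2 ⟨1, by rfl, by rfl⟩
    · obtain ⟨rfl, rfl⟩ := List.cons.inj hX
      obtain ⟨rfl, rfl⟩ := List.cons.inj hY
      exact (headsMatch_adj (Or.inl h)).2 ⟨1, by rfl, by rfl⟩
  | refl u =>
    obtain ⟨rfl, rfl⟩ := List.cons.inj (hX.symm.trans hY)
    exact headsMatch_self.2 rfl
  | symm h ih' =>
    exact (ih' (by rwa [mk_eq_of_rel h]) _ _ _ _ hY hX).symm
  | @trans u w v h1 h2 ih1 ih2 =>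
    have hw := mk_eq_of_rel h1
    rw [hw] at hu
    induction w using FreeMonoid.casesOn with
    | one =>
      have := congrArg length hw
      simp [hX] at this
    | of_mul k W =>
      refine HeadsMatch.trans ih ?_ (ih1 (hw ▸ hu) i k X W hX rfl) (ih2 hu k j W Y rfl hY)
      simpa [add_comm] using hu
  | @mul w x y z h1 h2 ih1 ih2 =>
    have h1' := mk_eq_of_rel h1
    have h2' := mk_eq_of_rel h2
    -- Congruent words have equal length, so the first factors are both empty or both carry the
    -- heads.
    have hl := congrArg length h1'
    simp only [map_mul, length_mul] at hu
    induction w using FreeMonoid.casesOn with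
    | one =>
      induction x using FreeMonoid.casesOn with
      | one => exact ih2 (by omega) i j X Y (by simpa using hX) (by simpa using hY)
      | of_mul => simp at hl; omega
    | of_mul i' w =>
      induction x using FreeMonoid.casesOn with
      | one => simp at hl
      | of_mul j' x =>
        rw [mul_assoc] at hX hY
        obtain ⟨rfl, rfl⟩ := List.cons.inj hX
        obtain ⟨rfl, rfl⟩ := List.cons.inj hY
        obtain ⟨Z, hZ, hZ'⟩ := ih1 (by omega) i' j' w x rfl rfl
        refine ⟨Z * PresentedMonoid.mk _ y, ?_, ?_⟩
        · exact (congrArg (· * PresentedMonoid.mk _ y) hZ).trans (mul_assoc _ _ _)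
        · rw [h2']
          exact (congrArg (· * PresentedMonoid.mk _ z) hZ').trans (mul_assoc _ _ _)

theorem headsMatchBelow (m n : ℕ) : HeadsMatchBelow m n := by
  induction n with
  | zero => intro i j X Y _ h; omega
  | succ n ih =>
    intro i j X Y h hl
    obtain ⟨X, rfl⟩ := PresentedMonoid.surjective_mk X
    obtain ⟨Y, rfl⟩ := PresentedMonoid.surjective_mk Y
    refine headsMatch_of_conGen ih (u := FreeMonoid.of i * X) (v := FreeMonoid.of j * Y)
      (PresentedMonoid.mk_eq_mk_iff.1 h) ?_ i j X Y rfl rfl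
    simp; omega

/-- Garside's lemma: equal products starting with `gen i` and `gen j` are a common multiple of
the least common multiple of these generators. -/
theorem headsMatch_of_eq {i j : Fin m} {X Y : BraidMonoid m} (h : gen i * X = gen j * Y) :
    HeadsMatch i X j Y :=
  headsMatchBelow m (length X + 2) i j X Y h (by omega)

theorem mul_left_cancel' (a : BraidMonoid m) {X Y : BraidMonoid m} (h : a * X = a * Y) :
    X = Y := by
  obtain ⟨a, rfl⟩ := PresentedMonoid.surjective_mk a
  induction a using FreeMonoid.inductionOn' generalizing X Y with
  | one => simpa using h
  | of_mul i a ih =>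
    simp only [map_mul, mk_of, mul_assoc] at h
    exact ih (headsMatch_self.1 (headsMatch_of_eq h))

end BraidMonoid

/-! ### Part: reversal, right cancellation and least common multiples. -/

namespace BraidMonoid

variable {m : ℕ}

theorem gen_induction {p : BraidMonoid m → Prop} (one : p 1)
    (gen_mul : ∀ i x, p x → p (gen i * x)) (x : BraidMonoid m) : p x := by
  obtain ⟨a, rfl⟩ := PresentedMonoid.surjective_mk x
  induction a using FreeMonoid.inductionOn' with
  | one => exact one
  | of_mul i a ih => exact gen_mul i _ ih

/-- The anti-automorphism reversing words, as a homomorphism to the opposite monoid. -/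
def revHom : BraidMonoid m →* (BraidMonoid m)ᵐᵒᵖ :=
  PresentedMonoid.lift (fun i => MulOpposite.op (gen i)) (by
    rintro _ _ (⟨i, j, h⟩ | ⟨i, j, h⟩)
    · simp [← MulOpposite.op_mul, gen_comm (Or.inl h)]
    · have := gen_braid (Or.inl h : Adj i j)
      simp [← MulOpposite.op_mul, ← mul_assoc, this])

/-- The anti-automorphism reversing words. -/
def rev (x : BraidMonoid m) : BraidMonoid m := (revHom x).unop

@[simp] theorem rev_one : rev (1 : BraidMonoid m) = 1 := by simp [rev]

@[simp] theorem rev_mul (x y : BraidMonoid m) : rev (x * y) = rev y * rev x := by simp [rev]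

@[simp] theorem rev_gen (i : Fin m) : rev (gen i) = gen i := rfl

@[simp] theorem rev_rev (x : BraidMonoid m) : rev (rev x) = x := by
  induction x using gen_induction with
  | one => simp
  | gen_mul i x ih => simp [ih]

instance : IsCancelMul (BraidMonoid m) where
  mul_left_cancel a _ _ h := mul_left_cancel' a h
  mul_right_cancel a x y h := by
    have : rev a * rev x = rev a * rev y := by
      rw [← rev_mul, ← rev_mul]; exact congrArg rev h
    simpa using congrArg rev (mul_left_cancel' _ this)

theorem gen_dvd_gen_mul {i j : Fin m} {x : BraidMonoid m} (h : gen i ∣ gen j * x) :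
    compl j i ∣ x := by
  obtain ⟨y, hy⟩ := h
  obtain ⟨Z, hZ, -⟩ := headsMatch_of_eq hy
  exact ⟨Z, hZ⟩

theorem mul_dvd_mul_left_iff' {a x y : BraidMonoid m} : a * x ∣ a * y ↔ x ∣ y := by
  refine ⟨fun ⟨c, hc⟩ => ⟨c, ?_⟩, fun ⟨c, hc⟩ => ⟨c, by rw [hc, mul_assoc]⟩⟩
  rw [mul_assoc] at hc
  exact mul_left_cancel hc

/-- `l` is a least common right multiple of `a` and `b`. -/
def IsLcm (a b l : BraidMonoid m) : Prop :=
  a ∣ l ∧ b ∣ l ∧ ∀ y, a ∣ y → b ∣ y → l ∣ y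

theorem IsLcm.mul_left {a b l : BraidMonoid m} (h : IsLcm a b l) (g : BraidMonoid m) :
    IsLcm (g * a) (g * b) (g * l) := by
  refine ⟨mul_dvd_mul_left_iff'.2 h.1, mul_dvd_mul_left_iff'.2 h.2.1, fun y h1 h2 => ?_⟩
  obtain ⟨y, rfl⟩ := (dvd_mul_right g a).trans h1
  rw [mul_dvd_mul_left_iff'] at *
  exact h.2.2 y h1 h2

/-- By Garside's lemma a common multiple of `gen i * a` and `gen j * b` is a multiple of `gen i *
compl i j`. Induction on the length of `x` gives least common multiples of `a` with `compl i j` and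
of `b` with `compl j i`, and then one of the two cofactors `u`, `v`. -/
theorem exists_isLcm_of_dvd {x a b : BraidMonoid m} (ha : a ∣ x) (hb : b ∣ x) :
    ∃ l, IsLcm a b l := by
  induction h : length x using Nat.strong_induction_on generalizing x a b with
  | _ n ih =>
    subst h
    rcases eq_one_or_exists_gen_mul a with rfl | ⟨i, a, rfl⟩
    · exact ⟨b, one_dvd _, dvd_rfl, fun y _ h => h⟩
    rcases eq_one_or_exists_gen_mul b with rfl | ⟨j, b, rfl⟩
    · exact ⟨_, dvd_rfl, one_dvd _, fun y h _ => h⟩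
    obtain ⟨X, rfl⟩ := (dvd_mul_right _ _).trans ha
    obtain ⟨Y, hY⟩ := (dvd_mul_right _ _).trans hb
    obtain ⟨Z, rfl, rfl⟩ := headsMatch_of_eq hY
    rw [mul_dvd_mul_left_iff'] at ha
    rw [hY, mul_dvd_mul_left_iff'] at hb
    have hl := congrArg length hY
    simp only [length_mul, length_gen] at hl
    obtain ⟨_, hu⟩ := ih _ (by simp) ha (dvd_mul_right (compl i j) Z) rfl
    obtain ⟨u, rfl⟩ := hu.2.1
    obtain ⟨_, hv⟩ := ih _ (by simp; omega) hb (dvd_mul_right (compl j i) Z) rfl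
    obtain ⟨v, rfl⟩ := hv.2.1
    have hu' := mul_dvd_mul_left_iff'.1 (hu.2.2 _ ha (dvd_mul_right _ _))
    have hv' := mul_dvd_mul_left_iff'.1 (hv.2.2 _ hb (dvd_mul_right _ _))
    obtain ⟨w, hw⟩ := ih _ (by simp; omega) hu' hv' rfl
    have hu2 := hu.mul_left (gen i)
    have hv2 := hv.mul_left (gen j)
    rw [← mul_assoc] at hu2 hv2
    rw [← gen_mul_compl] at hv2
    have hw2 := hw.mul_left (gen i * compl i j)
    refine ⟨_, hu2.1.trans hw2.1, hv2.1.trans hw2.2.1, fun y h1 h2 => ?_⟩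
    have h3 : gen i * compl i j ∣ y := by
      obtain ⟨X, rfl⟩ := (dvd_mul_right _ _).trans h1
      rw [mul_dvd_mul_left_iff']
      exact gen_dvd_gen_mul ((dvd_mul_right _ _).trans h2)
    exact hw2.2.2 y (hu2.2.2 y h1 h3) (hv2.2.2 y h2 h3)

end BraidMonoid

/-! ### Part: half twists in sequences satisfying the braid relations. -/

section HalfTwist

variable {M N : Type*} [Monoid M] [Monoid N]

/-- The product `s 0 * s 1 * ⋯ * s (k - 1)`. -/
def ascProd (s : ℕ → M) : ℕ → M
  | 0 => 1
  | k + 1 => ascProd s k * s k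

/-- The product `s (k - 1) * ⋯ * s 1 * s 0`. -/
def descProd (s : ℕ → M) : ℕ → M
  | 0 => 1
  | k + 1 => s k * descProd s k

/-- The half twist in the first `k` terms of `s`. -/
def halfTwist (s : ℕ → M) : ℕ → M
  | 0 => 1
  | k + 1 => ascProd s (k + 1) * halfTwist s k

/-- The first `m` terms of `s` satisfy the braid relations. -/
structure IsBraidSeq (s : ℕ → M) (m : ℕ) : Prop where
  comm : ∀ i j, i + 2 ≤ j → j < m → s i * s j = s j * s i
  braid : ∀ i, i + 1 < m → s i * s (i + 1) * s i = s (i + 1) * s i * s (i + 1)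

theorem map_ascProd (f : M →* N) (s : ℕ → M) (k : ℕ) :
    f (ascProd s k) = ascProd (fun i => f (s i)) k := by
  induction k with
  | zero => simp [ascProd]
  | succ k ih => simp [ascProd, ih]

theorem map_halfTwist (f : M →* N) (s : ℕ → M) (k : ℕ) :
    f (halfTwist s k) = halfTwist (fun i => f (s i)) k := by
  induction k with
  | zero => simp [halfTwist]
  | succ k ih => simp [halfTwist, ih, map_ascProd]

theorem ascProd_eq_prod_range (s : ℕ → M) (k : ℕ) :
    ascProd s k = ((List.range k).map s).prod := by
  induction k with
  | zero => simp [ascProd]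
  | succ k ih => simp [ascProd, ih, List.range_succ]

theorem halfTwist_eq_prod_range (s : ℕ → M) (k : ℕ) :
    halfTwist s k = ((List.range k).reverse.map fun i => ascProd s (i + 1)).prod := by
  induction k with
  | zero => simp [halfTwist]
  | succ k ih => simp [halfTwist, ih, List.range_succ]

namespace IsBraidSeq

variable {s : ℕ → M} {m : ℕ}

theorem commute_ascProd (hs : IsBraidSeq s m) {k j : ℕ} (hk : k + 1 ≤ j) (hj : j < m) :
    Commute (ascProd s k) (s j) := by
  induction k with
  | zero => exact Commute.one_left _
  | succ k ih => exact (ih (by omega)).mul_left (hs.comm k j (by omega) hj)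

theorem commute_descProd (hs : IsBraidSeq s m) {k j : ℕ} (hk : k + 1 ≤ j) (hj : j < m) :
    Commute (descProd s k) (s j) := by
  induction k with
  | zero => exact Commute.one_left _
  | succ k ih => exact Commute.mul_left (hs.comm k j (by omega) hj) (ih (by omega))

theorem commute_halfTwist (hs : IsBraidSeq s m) {k j : ℕ} (hk : k + 1 ≤ j) (hj : j < m) :
    Commute (halfTwist s k) (s j) := by
  induction k with
  | zero => exact Commute.one_left _
  | succ k ih => exact (hs.commute_ascProd hk hj).mul_left (ih (by omega))

theorem ascProd_mul (hs : IsBraidSeq s m) {k i : ℕ} (hi : i + 1 < k) (hk : k ≤ m) :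
    ascProd s k * s i = s (i + 1) * ascProd s k := by
  induction k with
  | zero => omega
  | succ k ih =>
    rcases Nat.lt_or_ge (i + 1) k with h | h
    · rw [ascProd, mul_assoc, ← hs.comm i k (by omega) (by omega), ← mul_assoc, ih h (by omega),
        mul_assoc]
    · obtain rfl : k = i + 1 := by omega
      simp only [ascProd]
      rw [mul_assoc, mul_assoc, ← mul_assoc (s i), hs.braid i (by omega), ← mul_assoc, ← mul_assoc,
        (hs.commute_ascProd le_rfl (by omega)).eq]
      simp only [mul_assoc]

theorem mul_descProd (hs : IsBraidSeq s m) {k i : ℕ} (hi : i + 1 < k) (hk : k ≤ m) :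
    s i * descProd s k = descProd s k * s (i + 1) := by
  induction k with
  | zero => omega
  | succ k ih =>
    rcases Nat.lt_or_ge (i + 1) k with h | h
    · rw [descProd, ← mul_assoc, hs.comm i k (by omega) (by omega), mul_assoc, ih h (by omega),
        mul_assoc]
    · obtain rfl : k = i + 1 := by omega
      simp only [descProd]
      rw [← mul_assoc, ← mul_assoc, hs.braid i (by omega), mul_assoc, mul_assoc, mul_assoc,
        mul_assoc, (hs.commute_descProd le_rfl (by omega)).eq]

/-- The mirror recursion: a descending factor is split off on the right. It gives access to the last
generator, which the defining recursion handles badly. -/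
theorem halfTwist_succ (hs : IsBraidSeq s m) {k : ℕ} (hk : k + 1 ≤ m) :
    halfTwist s (k + 1) = halfTwist s k * descProd s (k + 1) := by
  induction k with
  | zero => simp [halfTwist, ascProd, descProd]
  | succ k ih =>
    calc ascProd s (k + 2) * halfTwist s (k + 1)
        = ascProd s (k + 1) * ((s (k + 1) * halfTwist s k) * descProd s (k + 1)) := by
          rw [ih (by omega), ascProd]; simp only [mul_assoc]
      _ = ascProd s (k + 1) * halfTwist s k * (s (k + 1) * descProd s (k + 1)) := by
          rw [← (hs.commute_halfTwist le_rfl (by omega)).eq]; simp only [mul_assoc]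

theorem halfTwist_mul (hs : IsBraidSeq s m) {k i : ℕ} (hi : i < k) (hk : k ≤ m) :
    halfTwist s k * s i = s (k - 1 - i) * halfTwist s k := by
  induction k generalizing i with
  | zero => omega
  | succ k ih =>
    rcases Nat.lt_or_ge i k with h | h
    · rw [halfTwist, mul_assoc, ih h (by omega), ← mul_assoc,
        hs.ascProd_mul (by omega) (by omega), mul_assoc]
      congr 2; omega
    · obtain rfl : i = k := by omega
      rcases i with _ | i
      · simp [halfTwist, ascProd]
      -- Passing the descending factor turns the last generator into the preceding one, to which the
      -- induction hypothesis applies.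
      · have h1 := ih (i := i) (by omega) (by omega)
        simp only [Nat.add_sub_cancel, Nat.sub_self] at h1 ⊢
        rw [hs.halfTwist_succ hk, mul_assoc, ← hs.mul_descProd (by omega) hk, ← mul_assoc, h1,
          mul_assoc]

theorem dvd_halfTwist (hs : IsBraidSeq s m) {k i : ℕ} (hi : i < k) (hk : k ≤ m) :
    s i ∣ halfTwist s k := by
  induction k generalizing i with
  | zero => omega
  | succ k ih =>
    rcases Nat.lt_or_ge i k with h | h
    · rw [hs.halfTwist_succ hk]
      exact (ih h (by omega)).mul_right _
    · obtain rfl : i = k := by omega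
      rcases i with _ | i
      · simp [halfTwist, ascProd]
      · obtain ⟨t, ht⟩ := ih (i := i) (by omega) (by omega)
        rw [halfTwist, ht, ← mul_assoc, hs.ascProd_mul (by omega) hk, mul_assoc]
        exact dvd_mul_right _ _

end IsBraidSeq

end HalfTwist

/-! ### Part: the fundamental element as least common multiple of the generators. -/

namespace BraidMonoid

variable {m : ℕ}

/-- The generators, continued by `1`. -/
def seq (m : ℕ) (i : ℕ) : BraidMonoid m := if h : i < m then gen ⟨i, h⟩ else 1

theorem seq_of_lt {i : ℕ} (h : i < m) : seq m i = gen ⟨i, h⟩ := dif_pos h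

theorem isBraidSeq_seq (m : ℕ) : IsBraidSeq (seq m) m where
  comm i j h hj := by
    rw [seq_of_lt hj, seq_of_lt (by omega)]
    exact gen_comm (Or.inl h)
  braid i h := by
    rw [seq_of_lt h, seq_of_lt (by omega)]
    exact gen_braid (Or.inl rfl)

theorem seq_dvd_ascProd_mul {j k : ℕ} (hk : k < j) (hj : j < m) {w : BraidMonoid m}
    (h : seq m j ∣ ascProd (seq m) k * w) : seq m j ∣ w := by
  induction k generalizing w with
  | zero => simpa [ascProd] using h
  | succ k ih =>
    rw [ascProd, mul_assoc] at h
    have h1 := ih (by omega) h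
    rw [seq_of_lt hj, seq_of_lt (by omega)] at h1
    have h2 := gen_dvd_gen_mul h1
    rwa [compl_of_far (Or.inl (by change k + 2 ≤ j; omega)), ← seq_of_lt hj] at h2

theorem seq_dvd_halfTwist_mul {j k : ℕ} (hk : k < j) (hj : j < m) {w : BraidMonoid m}
    (h : seq m j ∣ halfTwist (seq m) k * w) : seq m j ∣ w := by
  induction k generalizing w with
  | zero => simpa [halfTwist] using h
  | succ k ih =>
    rw [halfTwist, mul_assoc] at h
    exact ih (by omega) (seq_dvd_ascProd_mul hk hj h)

/-- A generator of the half twist that commutes with `seq m k` can be dropped from the divisibility;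
its neighbour has a complement of length two, which forces the next letter of the descending product
to divide what remains. -/
theorem descProd_dvd {k : ℕ} (hk : k < m) {y : BraidMonoid m}
    (h : seq m k ∣ halfTwist (seq m) k * y) : descProd (seq m) (k + 1) ∣ y := by
  induction k generalizing y with
  | zero => simpa [halfTwist, descProd] using h
  | succ k ih =>
    rw [halfTwist, ascProd, mul_assoc, mul_assoc] at h
    have h1 := seq_dvd_ascProd_mul (by omega) hk h
    rw [seq_of_lt hk, seq_of_lt (by omega)] at h1
    have h2 := gen_dvd_gen_mul h1
    rw [compl_of_adj (Or.inl rfl), ← seq_of_lt hk, ← seq_of_lt (by omega)] at h2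
    obtain ⟨y, rfl⟩ := seq_dvd_halfTwist_mul (by omega) hk ((dvd_mul_right _ _).trans h2)
    rw [← mul_assoc, ((isBraidSeq_seq m).commute_halfTwist le_rfl hk).eq, mul_assoc,
      mul_dvd_mul_left_iff'] at h2
    rw [descProd, mul_dvd_mul_left_iff']
    exact ih (by omega) h2

theorem halfTwist_dvd {k : ℕ} (hk : k ≤ m) {x : BraidMonoid m}
    (h : ∀ i < k, seq m i ∣ x) : halfTwist (seq m) k ∣ x := by
  induction k with
  | zero => exact one_dvd _
  | succ k ih =>
    obtain ⟨y, rfl⟩ := ih (by omega) fun i hi => h i (by omega)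
    rw [(isBraidSeq_seq m).halfTwist_succ hk, mul_dvd_mul_left_iff']
    exact descProd_dvd hk (h k (by omega))

/-- Garside's fundamental element. -/
def delta (m : ℕ) : BraidMonoid m := halfTwist (seq m) m

theorem delta_dvd {x : BraidMonoid m} (h : ∀ i, gen i ∣ x) : delta m ∣ x :=
  halfTwist_dvd le_rfl fun i hi => by rw [seq_of_lt hi]; exact h _

theorem gen_dvd_delta (i : Fin m) : gen i ∣ delta m := by
  have := (isBraidSeq_seq m).dvd_halfTwist i.2 le_rfl
  rwa [seq_of_lt i.2] at this

theorem delta_mul_gen (i : Fin m) : delta m * gen i = gen i.rev * delta m := by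
  have h1 := (isBraidSeq_seq m).halfTwist_mul i.2 le_rfl
  have h2 : i.rev = ⟨m - 1 - i, by omega⟩ := by ext; simp only [Fin.val_rev]; omega
  rw [seq_of_lt i.2, seq_of_lt (by omega)] at h1
  rw [h2]
  exact h1

theorem delta_mul_delta_comm (x : BraidMonoid m) :
    delta m * delta m * x = x * (delta m * delta m) := by
  induction x using gen_induction with
  | one => simp
  | gen_mul i x ih =>
    rw [← mul_assoc, mul_assoc (delta m), delta_mul_gen, ← mul_assoc (delta m), delta_mul_gen,
      Fin.rev_rev, mul_assoc, mul_assoc, ← mul_assoc (delta m), ih, mul_assoc]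

/-- Every generator divides the central element `delta m * delta m`, so one power suffices for each
letter of `x`. -/
theorem dvd_pow_delta (x : BraidMonoid m) : ∃ k, x ∣ (delta m * delta m) ^ k := by
  induction x using gen_induction with
  | one => exact ⟨0, one_dvd _⟩
  | gen_mul i x ih =>
    obtain ⟨k, y, hy⟩ := ih
    refine ⟨k + 1, ?_⟩
    obtain ⟨t, ht⟩ := (gen_dvd_delta i).mul_right (delta m)
    have hc : Commute ((delta m * delta m) ^ k) t :=
      (show Commute (delta m * delta m) t from delta_mul_delta_comm t).pow_left k
    refine ⟨y * t, ?_⟩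
    calc (delta m * delta m) ^ (k + 1) = gen i * (t * (delta m * delta m) ^ k) := by
          rw [← mul_assoc, ← ht, pow_succ']
      _ = gen i * x * (y * t) := by rw [← hc.eq, hy]; simp only [mul_assoc]

end BraidMonoid

/-! ### Part: powers of the fundamental element and the Ore embedding. -/

namespace BraidMonoid

variable {m : ℕ}

theorem gen_injective : Function.Injective (gen : Fin m → BraidMonoid m) := by
  intro i j h
  obtain ⟨Z, hZ, -⟩ := headsMatch_of_eq (X := 1) (Y := 1) (by simpa using h)
  have hl := congrArg length hZ
  rcases eq_or_adj_or_far i j with rfl | h | h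
  · rfl
  · simp [compl_of_adj h] at hl; omega
  · simp [compl_of_far h] at hl; omega

theorem exists_mul_eq_pow_delta (x : BraidMonoid m) :
    ∃ (k : ℕ) (y : BraidMonoid m), y * x = (delta m * delta m) ^ k := by
  obtain ⟨k, y, hy⟩ := dvd_pow_delta x
  refine ⟨k, y, mul_left_cancel (a := x) ?_⟩
  have hc : Commute ((delta m * delta m) ^ k) x :=
    (show Commute (delta m * delta m) x from delta_mul_delta_comm x).pow_left k
  rw [← mul_assoc, ← hy, hc.eq]

theorem exists_common_left_multiple (x y : BraidMonoid m) : ∃ u v, u * x = v * y := by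
  obtain ⟨k, a, ha⟩ := exists_mul_eq_pow_delta x
  obtain ⟨l, b, hb⟩ := exists_mul_eq_pow_delta y
  refine ⟨(delta m * delta m) ^ l * a, (delta m * delta m) ^ k * b, ?_⟩
  rw [mul_assoc, mul_assoc, ha, hb, ← pow_add, ← pow_add, add_comm]

theorem exists_isLcm (a b : BraidMonoid m) : ∃ l, IsLcm a b l := by
  obtain ⟨k, hk⟩ := dvd_pow_delta a
  obtain ⟨l, hl⟩ := dvd_pow_delta b
  refine exists_isLcm_of_dvd (x := (delta m * delta m) ^ (k + l)) ?_ ?_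
  · rw [pow_add]; exact hk.mul_right _
  · rw [add_comm, pow_add]; exact hl.mul_right _

/-- Needed for the powers of a torsion braid, which are permuted by multiplication. -/
theorem exists_lcm_family (a : ℕ → BraidMonoid m) (k : ℕ) :
    ∃ l, (∀ i < k, a i ∣ l) ∧ ∀ y, (∀ i < k, a i ∣ y) → l ∣ y := by
  induction k with
  | zero => exact ⟨1, by simp, fun y _ => one_dvd y⟩
  | succ k ih =>
    obtain ⟨l, h1, h2⟩ := ih
    obtain ⟨l', h3, h4, h5⟩ := exists_isLcm l (a k)
    refine ⟨l', fun i hi => ?_, fun y hy =>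
      h5 y (h2 y fun i hi => hy i (by omega)) (hy k (by omega))⟩
    rcases Nat.lt_succ_iff_lt_or_eq.1 hi with h | rfl
    · exact (h1 i h).trans h3
    · exact h4

/-- The graph of adjacent indices is a path, hence connected. -/
theorem adj_closed_eq_univ {p : Fin m → Prop} (hp : ∀ i j, Adj i j → p i → p j) {i : Fin m}
    (hi : p i) (j : Fin m) : p j := by
  have up : ∀ k (h : (i : ℕ) + k < m), p ⟨i + k, h⟩ := by
    intro k
    induction k with
    | zero => intro _; exact hi
    | succ k ih => intro h; exact hp _ _ (Or.inl rfl) (ih (by omega))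
  have down : ∀ k (h : (i : ℕ) - k < m), p ⟨i - k, h⟩ := by
    intro k
    induction k with
    | zero => intro _; exact hi
    | succ k ih =>
      intro h
      rcases Nat.eq_zero_or_pos ((i : ℕ) - k) with h0 | h0
      · convert ih (by omega) using 2; omega
      · refine hp _ _ (Or.inr ?_) (ih (by omega))
        change (i : ℕ) - (k + 1) + 1 = i - k
        omega
  rcases Nat.le_total i j with h | h
  · convert up (j - i) (by omega) using 1; ext; simp only; omega
  · convert down (i - j) (by omega) using 1; ext; simp only; omega

/-- An element that conjugates generators to generators is a power of the fundamental element. -/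
theorem exists_eq_pow_delta {x : BraidMonoid m} (hx : ∀ i, ∃ j, gen i * x = x * gen j) :
    ∃ k, x = delta m ^ k := by
  induction h : length x using Nat.strong_induction_on generalizing x with
  | _ n ih =>
    subst h
    rcases eq_one_or_exists_gen_mul x with rfl | ⟨i, y, hy⟩
    · exact ⟨0, by simp⟩
    have hall : ∀ j, gen j ∣ x := by
      refine adj_closed_eq_univ (fun i j hij hi => ?_) (i := i) ⟨y, hy⟩
      obtain ⟨i', hi'⟩ := hx i
      obtain ⟨j', hj'⟩ := hx j
      -- Since `x` moves generators across itself, `gen j * gen i * x` is a right multiple of `x`,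
      -- hence of `gen i`; the complement of the adjacent pair then puts `gen j` in front of `x`.
      have h1 : gen i ∣ gen j * (gen i * x) := by
        rw [hi', ← mul_assoc, hj', mul_assoc]
        exact hi.mul_right _
      have h2 := gen_dvd_gen_mul h1
      rwa [compl_of_adj hij.symm, mul_dvd_mul_left_iff'] at h2
    obtain ⟨y, rfl⟩ := delta_dvd hall
    obtain ⟨t, ht⟩ := gen_dvd_delta i
    obtain ⟨k, rfl⟩ := ih (length y) (by simp [ht]) (x := y) (fun j => by
      obtain ⟨j', hj'⟩ := hx j.rev
      refine ⟨j', mul_left_cancel (a := delta m) ?_⟩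
      rw [← mul_assoc, delta_mul_gen, mul_assoc, hj', mul_assoc]) rfl
    exact ⟨k + 1, (pow_succ' _ _).symm⟩

noncomputable instance : OreLocalization.OreSet (⊤ : Submonoid (BraidMonoid m)) where
  ore_right_cancel r₁ r₂ s h := ⟨1, by rw [mul_right_cancel h]⟩
  oreNum r s := (exists_common_left_multiple r s).choose_spec.choose
  oreDenom r s := ⟨(exists_common_left_multiple r s).choose, trivial⟩
  ore_eq r s := (exists_common_left_multiple r s).choose_spec.choose_spec

/-- The embedding of the braid monoid into the units of its localization. -/
noncomputable def toUnits :
    BraidMonoid m →* (OreLocalization (⊤ : Submonoid (BraidMonoid m)) (BraidMonoid m))ˣ where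
  toFun x := OreLocalization.numeratorUnit ⟨x, trivial⟩
  map_one' := Units.ext (map_one OreLocalization.numeratorHom)
  map_mul' x y := Units.ext (map_mul OreLocalization.numeratorHom x y)

theorem toUnits_injective : Function.Injective (toUnits (m := m)) := by
  intro x y h
  have h1 := congrArg Units.val h
  obtain ⟨u, v, h2, h3⟩ := OreLocalization.oreDiv_eq_iff.1 h1
  have h4 : (u : BraidMonoid m) = v := by simpa using h3
  have h5 : (u : BraidMonoid m) * y = v * x := h2
  rw [h4] at h5
  exact (mul_left_cancel h5).symm

end BraidMonoid

/-! ### Part: the monoid inside the braid group; torsion and centre. -/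

namespace BraidGroup

open BraidMonoid

variable {n : ℕ}

theorem σ_comm {i j : Fin (n - 1)} (h : (i : ℕ) + 2 ≤ j) :
    σ i * σ j = (σ j * σ i : BraidGroup n) := by
  have := PresentedGroup.one_of_mem (rels := braidRelators n) (Or.inl ⟨i, j, h, rfl⟩)
  rwa [map_mul, map_inv, mul_inv_eq_one] at this

theorem σ_braid {i j : Fin (n - 1)} (h : (i : ℕ) + 1 = j) :
    σ i * σ j * σ i = (σ j * σ i * σ j : BraidGroup n) := by
  have := PresentedGroup.one_of_mem (rels := braidRelators n) (Or.inr ⟨i, j, h, rfl⟩)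
  rwa [map_mul, map_inv, mul_inv_eq_one] at this

/-- A homomorphism from the braid group, given by elements satisfying the braid relations. -/
def toGroup {G : Type*} [Group G] (f : Fin (n - 1) → G)
    (h1 : ∀ i j : Fin (n - 1), (i : ℕ) + 2 ≤ j → f i * f j = f j * f i)
    (h2 : ∀ i j : Fin (n - 1), (i : ℕ) + 1 = j → f i * f j * f i = f j * f i * f j) :
    BraidGroup n →* G :=
  PresentedGroup.toGroup (f := f) (by
    rintro _ (⟨i, j, h, rfl⟩ | ⟨i, j, h, rfl⟩)
    · simp only [map_mul, map_inv, FreeGroup.lift_apply_of, mul_inv_eq_one, h1 i j h]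
    · simp only [map_mul, map_inv, FreeGroup.lift_apply_of, mul_inv_eq_one, h2 i j h])

@[simp] theorem toGroup_σ {G : Type*} [Group G] (f : Fin (n - 1) → G) (h1 h2) (i : Fin (n - 1)) :
    toGroup f h1 h2 (σ i : BraidGroup n) = f i :=
  PresentedGroup.toGroup.of _

theorem closure_range_σ : Subgroup.closure (Set.range (σ : Fin (n - 1) → BraidGroup n)) = ⊤ :=
  PresentedGroup.closure_range_of _

/-- The canonical map from the braid monoid to the braid group. -/
def ofMonoid (n : ℕ) : BraidMonoid (n - 1) →* BraidGroup n :=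
  PresentedMonoid.lift σ (by
    rintro _ _ (⟨i, j, h⟩ | ⟨i, j, h⟩)
    · simpa using σ_comm h
    · simpa using σ_braid h)

@[simp] theorem ofMonoid_gen (i : Fin (n - 1)) : ofMonoid n (gen i) = σ i := rfl

/-- The units of the Ore localization satisfy the braid relations, so the injective `toUnits`
factors through the braid group. -/
theorem ofMonoid_injective : Function.Injective (ofMonoid n) := by
  let f (i : Fin (n - 1)) := toUnits (gen i)
  have h1 (i j : Fin (n - 1)) (h : (i : ℕ) + 2 ≤ j) : f i * f j = f j * f i := by
    simp only [f, ← map_mul, gen_comm (Or.inl h)]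
  have h2 (i j : Fin (n - 1)) (h : (i : ℕ) + 1 = j) : f i * f j * f i = f j * f i * f j := by
    simp only [f, ← map_mul, gen_braid (Or.inl h)]
  have h : (toGroup f h1 h2).comp (ofMonoid n) = toUnits :=
    PresentedMonoid.ext _ fun i => toGroup_σ f h1 h2 i
  refine Function.Injective.of_comp (f := toGroup f h1 h2) ?_
  rw [← MonoidHom.coe_comp, h]
  exact toUnits_injective

/-- The exponent sum of a braid. -/
def deg (n : ℕ) : BraidGroup n →* Multiplicative ℤ :=
  toGroup (fun _ => Multiplicative.ofAdd 1) (fun _ _ _ => rfl) (fun _ _ _ => rfl)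

@[simp] theorem deg_σ (i : Fin (n - 1)) : deg n (σ i) = Multiplicative.ofAdd 1 := toGroup_σ _ _ _ i

theorem deg_ofMonoid (x : BraidMonoid (n - 1)) :
    deg n (ofMonoid n x) = Multiplicative.ofAdd (length x : ℤ) := by
  induction x using gen_induction with
  | one => simp
  | gen_mul i x ih => simp [ih, ofAdd_add]

theorem ofMonoid_delta : ofMonoid n (delta (n - 1)) = fundamental n := by
  have h0 : ((List.finRange (n - 1)).reverse >>= fun a => pure (a : ℕ)) =
      (List.range (n - 1)).reverse := by
    rw [← List.map_coe_finRange_eq_range, ← List.map_reverse]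
    exact List.flatMap_pure_eq_map _ _
  rw [delta, map_halfTwist, halfTwist_eq_prod_range, fundamental, h0]
  congr 1
  refine List.map_congr_left fun s hs => ?_
  rw [List.mem_reverse, List.mem_range] at hs
  have h1 : (List.finRange (n - 1)).map (σ : _ → BraidGroup n) =
      (List.range (n - 1)).map fun i => ofMonoid n (seq (n - 1) i) := by
    rw [← List.map_coe_finRange_eq_range, List.map_map]
    exact List.map_congr_left fun i _ => by simp [seq_of_lt i.2]
  rw [List.map_take, h1, ← List.map_take, List.take_range, ascProd_eq_prod_range,
    min_eq_left (by omega)]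

theorem ofMonoid_delta_mul_delta :
    ofMonoid n (delta (n - 1) * delta (n - 1)) = fundamental n ^ 2 := by
  rw [map_mul, ofMonoid_delta, sq]

theorem sq_fundamental_mem_center : fundamental n ^ 2 ∈ Subgroup.center (BraidGroup n) := by
  rw [← Subgroup.centralizer_univ, ← Subgroup.coe_top, ← closure_range_σ,
    Subgroup.centralizer_closure, Subgroup.mem_centralizer_iff]
  rintro _ ⟨i, rfl⟩
  rw [← ofMonoid_delta_mul_delta, ← ofMonoid_gen, ← map_mul, ← map_mul, delta_mul_delta_comm]

theorem commute_sq_fundamental (g : BraidGroup n) (k : ℕ) : Commute ((fundamental n ^ 2) ^ k) g :=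
  Commute.pow_left (Subgroup.mem_center_iff.1 sq_fundamental_mem_center g).symm k

theorem exists_positive (g : BraidGroup n) :
    ∃ (k : ℕ) (x : BraidMonoid (n - 1)), (fundamental n ^ 2) ^ k * g = ofMonoid n x := by
  have hg : g ∈ Subgroup.closure (Set.range (σ : Fin (n - 1) → BraidGroup n)) := by
    rw [closure_range_σ]; trivial
  induction hg using Subgroup.closure_induction with
  | mem g hg =>
    obtain ⟨i, rfl⟩ := hg
    exact ⟨0, gen i, by simp⟩
  | one => exact ⟨0, 1, by simp⟩
  | mul g h _ _ ihg ihh =>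
    obtain ⟨k, x, hx⟩ := ihg
    obtain ⟨l, y, hy⟩ := ihh
    refine ⟨k + l, x * y, ?_⟩
    rw [map_mul, ← hx, ← hy, pow_add, mul_assoc, mul_assoc, ← mul_assoc _ g,
      (commute_sq_fundamental g l).eq, mul_assoc]
  | inv g _ ih =>
    obtain ⟨k, x, hx⟩ := ih
    obtain ⟨l, y, hy⟩ := dvd_pow_delta x
    refine ⟨l, y * (delta _ * delta _) ^ k, ?_⟩
    have h := congrArg (ofMonoid n) hy
    rw [map_pow, ofMonoid_delta_mul_delta, map_mul, ← hx] at h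
    rw [map_mul, map_pow, ofMonoid_delta_mul_delta, (commute_sq_fundamental _ l).eq, h,
      (commute_sq_fundamental g k).eq, mul_assoc, inv_mul_cancel_left,
      (commute_sq_fundamental _ k).eq]

/-- If `g ^ k = 1`, a central power of `Δ²` makes `g ^ 0, …, g ^ (k - 1)` simultaneously positive.
Left multiplication by `g` permutes the resulting elements, so it sends their least common multiple
`l` to a common multiple `l * q`. As `g` has degree `0`, `q` has length `0`, whence `g = 1`. -/
theorem eq_one_of_isOfFinOrder {g : BraidGroup n} (hg : IsOfFinOrder g) : g = 1 := by
  obtain ⟨k, hk, hgk⟩ := isOfFinOrder_iff_pow_eq_one.1 hg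
  obtain ⟨a, x, hx⟩ := exists_positive g
  set D := delta (n - 1) * delta (n - 1) with hD
  have hpos : ∀ i ≤ k, ofMonoid n (x ^ i * D ^ (a * (k - i))) =
      (fundamental n ^ 2) ^ (a * k) * g ^ i := by
    intro i hi
    rw [map_mul, map_pow, map_pow, hD, ofMonoid_delta_mul_delta, ← hx,
      (commute_sq_fundamental g a).mul_pow, mul_assoc, ← (commute_sq_fundamental (g ^ i) _).eq,
      ← mul_assoc, ← pow_mul, ← pow_add, ← mul_add, Nat.add_sub_cancel' hi]
  obtain ⟨l, hl1, hl2⟩ := exists_lcm_family (fun i => x ^ i * D ^ (a * (k - i))) k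
  have key : ∀ i < k, ∃ p, g * ofMonoid n l = ofMonoid n (x ^ i * D ^ (a * (k - i)) * p) := by
    have step : ∀ j < k, ∃ p, g * ofMonoid n l =
        (fundamental n ^ 2) ^ (a * k) * g ^ (j + 1) * ofMonoid n p := by
      intro j hj
      obtain ⟨p, hp⟩ := hl1 j hj
      refine ⟨p, ?_⟩
      rw [hp, map_mul, hpos j hj.le, ← mul_assoc, ← mul_assoc, ← (commute_sq_fundamental g _).eq,
        mul_assoc _ g, ← pow_succ']
    intro i hi
    rcases i with _ | i
    -- The cycle closes here: the power with exponent `0` is `g` times the one with exponent `k -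
    -- 1`.
    · obtain ⟨p, hp⟩ := step (k - 1) (by omega)
      refine ⟨p, ?_⟩
      rw [map_mul, hpos 0 (by omega), hp, Nat.sub_add_cancel hk, hgk, pow_zero]
    · obtain ⟨p, hp⟩ := step i (by omega)
      refine ⟨p, ?_⟩
      rw [map_mul, hpos _ hi.le, hp]
  obtain ⟨p₀, hp₀⟩ := key 0 hk
  obtain ⟨q, hq⟩ := hl2 _ fun i hi => by
    obtain ⟨p, hp⟩ := key i hi
    exact ⟨p, ofMonoid_injective (hp₀.symm.trans hp)⟩
  rw [hq, map_mul] at hp₀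
  have hdeg : deg n g = 1 := by
    have : deg n g ^ k = 1 := by rw [← map_pow, hgk, map_one]
    exact (pow_eq_one_iff_left hk.ne').1 this
  have h1 := congrArg (deg n) hp₀
  rw [map_mul, hdeg, one_mul, map_mul, left_eq_mul, deg_ofMonoid] at h1
  have h2 : length q = 0 := by simpa using h1
  rw [length_eq_zero.1 h2, map_one, mul_one] at hp₀
  simpa using hp₀

theorem three_le_of_not_comm (h : ¬ ∀ a b : BraidGroup n, a * b = b * a) : 3 ≤ n := by
  by_contra! hn
  refine h fun a b => ?_
  have hc : ∀ b, b ∈ Subgroup.center (BraidGroup n) := by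
    have : (⊤ : Subgroup (BraidGroup n)) ≤ Subgroup.center _ := by
      rw [← Subgroup.centralizer_univ, ← Subgroup.coe_top, ← closure_range_σ,
        Subgroup.centralizer_closure, Subgroup.closure_le]
      rintro _ ⟨i, rfl⟩ _ ⟨j, rfl⟩
      obtain rfl : i = j := by ext; omega
      rfl
    exact fun b => this trivial
  exact Subgroup.mem_center_iff.1 (hc b) a

/-- Up to a power of `Δ²` a central element is positive and commutes with all generators, hence is a
power of `Δ`. An odd exponent would make `Δ` central, but conjugation by `Δ` reverses the order of
the generators and moves the first one. -/
theorem center_eq (hn : 3 ≤ n) :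
    Subgroup.center (BraidGroup n) = Subgroup.zpowers (fundamental n ^ 2) := by
  refine le_antisymm (fun z hz => ?_) (by simpa using sq_fundamental_mem_center)
  obtain ⟨a, x, hx⟩ := exists_positive z
  have hx' : ofMonoid n x ∈ Subgroup.center (BraidGroup n) :=
    hx ▸ mul_mem (pow_mem sq_fundamental_mem_center a) hz
  obtain ⟨k, rfl⟩ := exists_eq_pow_delta (x := x) fun i => ⟨i, ofMonoid_injective (by
    simpa using Subgroup.mem_center_iff.1 hx' (σ i))⟩
  rw [map_pow, ofMonoid_delta] at hx hx'
  have hk : Even k := by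
    by_contra hk
    obtain ⟨r, rfl⟩ := Nat.not_even_iff_odd.1 hk
    rw [pow_succ, pow_mul, Subgroup.mul_mem_cancel_left _
      (pow_mem sq_fundamental_mem_center r)] at hx'
    let i : Fin (n - 1) := ⟨0, by omega⟩
    have h1 := Subgroup.mem_center_iff.1 hx' (σ i)
    rw [← ofMonoid_delta, ← ofMonoid_gen, ← map_mul, ← map_mul, delta_mul_gen] at h1
    have h2 := congrArg Fin.val (gen_injective (mul_right_cancel (ofMonoid_injective h1)))
    simp [i, Fin.val_rev] at h2
    omega
  obtain ⟨r, rfl⟩ := hk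
  refine ⟨(r : ℤ) - a, ?_⟩
  simp only
  rw [zpow_sub, zpow_natCast, zpow_natCast, ← pow_mul, two_mul, ← hx]
  rw [(commute_sq_fundamental z a).eq, mul_inv_cancel_right]

end BraidGroup

/-! ### Part: the overgroup obtained from a power of `H` by a central twist. -/

/-- Pairs of residues modulo `d` that are not both even. -/
abbrev TwistIndex (d : ℕ) : Type := {p : Fin d × Fin d // ¬ (Even (p.1 : ℕ) ∧ Even (p.2 : ℕ))}

/-- The integral linear form attached to a pair of residues. -/
def TwistIndex.form {d : ℕ} (i : TwistIndex d) (a b : ℤ) : ℤ := (i.1.1 : ℕ) * a + (i.1.2 : ℕ) * b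

section CentralTwist

variable {H : Type} [Group H]

/-- The subgroup of the central elements `(ζ ^ ℓᵢ(a, b))ᵢ` of a power of `H`, where `ℓᵢ` runs over
the linear forms `TwistIndex.form`. -/
def centralTwist (d : ℕ) (ζ : H) : Subgroup (TwistIndex d → H) where
  carrier := {x | ∃ a b : ℤ, ∀ i, x i = ζ ^ i.form a b}
  one_mem' := ⟨0, 0, by simp [TwistIndex.form]⟩
  mul_mem' := by
    rintro x y ⟨a, b, h⟩ ⟨a', b', h'⟩
    refine ⟨a + a', b + b', fun i => ?_⟩
    rw [Pi.mul_apply, h, h', ← zpow_add]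
    congr 1
    simp only [TwistIndex.form]
    ring
  inv_mem' := by
    rintro x ⟨a, b, h⟩
    refine ⟨-a, -b, fun i => ?_⟩
    rw [Pi.inv_apply, h, ← zpow_neg]
    congr 1
    simp only [TwistIndex.form]
    ring

theorem centralTwist_normal (d : ℕ) {ζ : H} (hζ : ζ ∈ Subgroup.center H) :
    (centralTwist d ζ).Normal where
  conj_mem := by
    rintro x ⟨a, b, h⟩ g
    refine ⟨a, b, fun i => ?_⟩
    have := Subgroup.mem_center_iff.1 (zpow_mem hζ (i.form a b)) (g i)
    rw [Pi.mul_apply, Pi.mul_apply, Pi.inv_apply, h, this, mul_inv_cancel_right]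

/-- Words that have equal values in `H` up to a central twist take that value in `H`. -/
def AbsorbsTwists (d : ℕ) (ζ : H) : Prop :=
  ∀ (X : Type) [Finite X] (w : FreeGroup X) (x : TwistIndex d → X → H) (h : H) (a b : ℤ),
    (∀ i, FreeGroup.lift (x i) w = h * ζ ^ i.form a b) → ∃ y : X → H, FreeGroup.lift y w = h

/-- The diagonal map from `H` to the quotient of its power by the central twist. -/
def twistDiag (d : ℕ) (ζ : H) [(centralTwist d ζ).Normal] :
    H →* (TwistIndex d → H) ⧸ centralTwist d ζ :=
  (QuotientGroup.mk' _).comp (Pi.constMonoidHom (TwistIndex d) H)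

theorem lift_map_apply {X G G' : Type*} [Group G] [Group G'] (f : G →* G') (x : X → G)
    (w : FreeGroup X) : f (FreeGroup.lift x w) = FreeGroup.lift (fun i => f (x i)) w :=
  DFunLike.congr_fun (FreeGroup.ext_hom (f.comp (FreeGroup.lift x))
    (FreeGroup.lift fun i => f (x i)) (by simp)) w

/-- The indices `(1, 0)`, `(0, 1)`, `(1, 1)` give `h = ζ ^ a = ζ ^ b = ζ ^ (a + b)`, so `h = h * h`.
-/
theorem twistDiag_injective {d : ℕ} (hd : 2 ≤ d) (ζ : H) [(centralTwist d ζ).Normal] :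
    Function.Injective (twistDiag d ζ) := by
  rw [injective_iff_map_eq_one]
  intro h hh
  obtain ⟨a, b, hab⟩ := (QuotientGroup.eq_one_iff _).1 hh
  have h1 := hab ⟨(⟨1, by omega⟩, ⟨0, by omega⟩), by simp⟩
  have h2 := hab ⟨(⟨0, by omega⟩, ⟨1, by omega⟩), by simp⟩
  have h3 := hab ⟨(⟨1, by omega⟩, ⟨1, by omega⟩), by simp⟩
  simp only [TwistIndex.form, Nat.cast_one, Nat.cast_zero, one_mul, zero_mul, add_zero,
    zero_add, zpow_add] at h1 h2 h3
  simp only [Pi.constMonoidHom_apply, Function.const_apply] at h1 h2 h3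
  rw [← h1, ← h2, left_eq_mul] at h3
  exact h3

theorem isVerballyClosed_range_twistDiag {d : ℕ} {ζ : H} [(centralTwist d ζ).Normal]
    (h : AbsorbsTwists d ζ) : IsVerballyClosed (twistDiag d ζ).range := by
  intro X _ w ⟨_, h₀, rfl⟩
  constructor
  · rintro ⟨f, hf⟩
    choose x hx using fun t => QuotientGroup.mk'_surjective (centralTwist d ζ) (f t)
    obtain rfl : (fun t => QuotientGroup.mk' (centralTwist d ζ) (x t)) = f := funext hx
    rw [← lift_map_apply] at hf
    obtain ⟨a, b, hab⟩ := QuotientGroup.eq.1 hf.symm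
    obtain ⟨y, hy⟩ := h X w (fun i t => x t i) h₀ a b fun i => by
      have h1 := hab i
      have h2 := lift_map_apply (Pi.evalMonoidHom (fun _ : TwistIndex d => H) i) x w
      simp only [Pi.evalMonoidHom_apply] at h2
      rw [← h2, ← h1]
      simp
    exact ⟨fun t => (twistDiag d ζ).rangeRestrict (y t), by rw [← lift_map_apply, hy]; rfl⟩
  · rintro ⟨f, hf⟩
    refine ⟨fun t => f t, ?_⟩
    rw [← hf]
    exact (lift_map_apply (Subgroup.subtype _) f w).symm

theorem list_prod_mulSingle {I : Type*} [Fintype I] [DecidableEq I] (x : I → H) :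
    ((Finset.univ : Finset I).toList.map fun i => Pi.mulSingle (M := fun _ => H) i (x i)).prod =
      x := by
  have h := Finset.noncommProd_toFinset (Finset.univ : Finset I).toList
    (fun i => Pi.mulSingle (M := fun _ => H) i (x i))
    (fun i _ j _ _ => Pi.mulSingle_apply_commute x i j) (Finset.nodup_toList _)
  rw [← h]
  simp only [Finset.toList_toFinset]
  exact Finset.noncommProd_mulSingle x

/-- If a strongly verbally closed group absorbs central twists, then it carries a family of
commuting approximate copies of any finite tuple, whose product is the tuple itself. -/
theorem IsStronglyVerballyClosed.exists_commuting_family (hH : IsStronglyVerballyClosed H)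
    {d : ℕ} (hd : 2 ≤ d) {ζ : H} (hζ : ζ ∈ Subgroup.center H) (habs : AbsorbsTwists d ζ)
    {K : Type} [Finite K] (h : K → H) {R : Set (FreeGroup K)} (hRf : R.Finite)
    (hR : ∀ r ∈ R, FreeGroup.lift h r = 1) {z : FreeGroup K} (hz : FreeGroup.lift h z = ζ)
    {T : Set (ℤ × ℤ)} (hT : T.Finite) :
    ∃ x : TwistIndex d → K → H,
      (∀ i j, i ≠ j → ∀ k l, Commute (x i k) (x j l)) ∧
      (∀ k, ((Finset.univ : Finset (TwistIndex d)).toList.map fun i => x i k).prod = h k) ∧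
      (∀ i, ∀ r ∈ R, FreeGroup.lift (x i) r = 1) ∧
      (∀ t ∈ T, ((Finset.univ : Finset (TwistIndex d)).toList.map fun i =>
        FreeGroup.lift (x i) z ^ i.form t.1 t.2).prod = 1) := by
  have := centralTwist_normal d hζ
  let φ := twistDiag d ζ
  have hφ : Function.Injective φ := twistDiag_injective hd ζ
  have hac := hH _ φ hφ (isVerballyClosed_range_twistDiag habs)
  let place (i : TwistIndex d) : FreeGroup K →* FreeGroup (TwistIndex d × K) :=
    FreeGroup.map fun k => (i, k)
  let inl : φ.range →* Monoid.Coprod φ.range (FreeGroup (TwistIndex d × K)) :=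
    Monoid.Coprod.inl
  let inr : FreeGroup (TwistIndex d × K) →*
      Monoid.Coprod φ.range (FreeGroup (TwistIndex d × K)) := Monoid.Coprod.inr
  -- The four sets of equations say: distinct copies commute; the copies of `h k` multiply to its
  -- diagonal image; each copy satisfies `R`; the copies of `z`, raised to the values of the forms
  -- at `t`, multiply to `1`.
  let S₁ : Set (Monoid.Coprod φ.range (FreeGroup (TwistIndex d × K))) := Set.range
    fun p : {p : TwistIndex d × TwistIndex d // p.1 ≠ p.2} × K × K =>
      inr (FreeGroup.of (p.1.1.1, p.2.1) * FreeGroup.of (p.1.1.2, p.2.2) *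
        (FreeGroup.of (p.1.1.2, p.2.2) * FreeGroup.of (p.1.1.1, p.2.1))⁻¹)
  let S₂ : Set (Monoid.Coprod φ.range (FreeGroup (TwistIndex d × K))) := Set.range fun k =>
    inl (φ.rangeRestrict (h k))⁻¹ *
      inr ((Finset.univ : Finset (TwistIndex d)).toList.map fun i => FreeGroup.of (i, k)).prod
  let S₃ : Set (Monoid.Coprod φ.range (FreeGroup (TwistIndex d × K))) := Set.range
    fun p : TwistIndex d × R => inr (place p.1 p.2.1)
  let S₄ : Set (Monoid.Coprod φ.range (FreeGroup (TwistIndex d × K))) := Set.range fun t : T =>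
    inr ((Finset.univ : Finset (TwistIndex d)).toList.map
      fun i => place i z ^ i.form t.1.1 t.1.2).prod
  have hplace {G : Type} [Group G] (f : TwistIndex d × K → G) (i : TwistIndex d)
      (w : FreeGroup K) : FreeGroup.lift f (place i w) = FreeGroup.lift (fun k => f (i, k)) w := by
    simp only [place, FreeGroup.map_eq_lift, lift_map_apply, FreeGroup.lift_apply_of,
      Function.comp_def]
  have := hRf.to_subtype
  have := hT.to_subtype
  obtain ⟨f, hf⟩ := (hac (TwistIndex d × K) (S₁ ∪ S₂ ∪ S₃ ∪ S₄)
    ((((Set.finite_range _).union (Set.finite_range _)).union (Set.finite_range _)).union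
      (Set.finite_range _))).1 (by
    let mk := QuotientGroup.mk' (centralTwist d ζ)
    let sgl (i : TwistIndex d) := MonoidHom.mulSingle (fun _ : TwistIndex d => H) i
    -- In the overgroup, the copies of `h` placed in the separate coordinates solve the system.
    refine ⟨fun p => mk (sgl p.1 (h p.2)), ?_⟩
    have hval (i : TwistIndex d) (w : FreeGroup K) :
        FreeGroup.lift (fun k => mk (sgl i (h k))) w = mk (sgl i (FreeGroup.lift h w)) := by
      rw [lift_map_apply (sgl i), lift_map_apply mk]
    rintro _ (((⟨⟨⟨⟨i, j⟩, hij⟩, k, l⟩, rfl⟩ | ⟨k, rfl⟩) | ⟨⟨i, r, hr⟩, rfl⟩) | ⟨⟨t, ht⟩, rfl⟩)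
    · simp only [inr, Monoid.Coprod.lift_apply_inr, map_mul, map_inv, mul_inv_eq_one,
        FreeGroup.lift_apply_of]
      simp only [← map_mul]
      congr 1
      exact Pi.mulSingle_commute hij _ _
    · simp only [inl, inr, map_mul, Monoid.Coprod.lift_apply_inr, Monoid.Coprod.lift_apply_inl,
        map_list_prod, List.map_map, Function.comp_def, FreeGroup.lift_apply_of]
      rw [← Function.comp_def mk, ← List.map_map, ← map_list_prod]
      rw [show ((Finset.univ : Finset (TwistIndex d)).toList.map fun i => sgl i (h k)).prod =
        fun _ => h k from list_prod_mulSingle fun _ => h k]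
      exact inv_mul_cancel (φ (h k))
    · simp only [inr, Monoid.Coprod.lift_apply_inr, hplace, hval, hR r hr, map_one]
    · simp only [inr, Monoid.Coprod.lift_apply_inr, map_list_prod, List.map_map,
        Function.comp_def, map_zpow, hplace, hval, hz]
      simp only [← map_zpow]
      rw [← Function.comp_def mk, ← List.map_map, ← map_list_prod]
      rw [show ((Finset.univ : Finset (TwistIndex d)).toList.map fun i =>
        sgl i (ζ ^ i.form t.1 t.2)).prod = fun i => ζ ^ i.form t.1 t.2 from
        list_prod_mulSingle fun i : TwistIndex d => ζ ^ i.form t.1 t.2]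
      -- This product is a generic member of the subgroup that was factored out.
      exact (QuotientGroup.eq_one_iff _).2 ⟨t.1, t.2, fun _ => rfl⟩)
  let e : φ.range →* H := (MonoidHom.ofInjective hφ).symm.toMonoidHom
  have he (g : H) : e (φ.rangeRestrict g) = g := (MonoidHom.ofInjective hφ).symm_apply_apply g
  have hlift (i : TwistIndex d) (w : FreeGroup K) :
      FreeGroup.lift (fun k => e (f (i, k))) w = e (FreeGroup.lift f (place i w)) := by
    rw [hplace, lift_map_apply]
  refine ⟨fun i k => e (f (i, k)), fun i j hij k l => ?_, fun k => ?_, fun i r hr => ?_,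
    fun t ht => ?_⟩
  · have h1 := hf _ (Or.inl (Or.inl (Or.inl ⟨⟨⟨(i, j), hij⟩, k, l⟩, rfl⟩)))
    simp only [inr, Monoid.Coprod.lift_apply_inr, map_mul, map_inv, mul_inv_eq_one,
      FreeGroup.lift_apply_of] at h1
    exact Commute.map h1 e
  · have h1 := hf _ (Or.inl (Or.inl (Or.inr ⟨k, rfl⟩)))
    simp only [inl, inr, map_mul, Monoid.Coprod.lift_apply_inr, Monoid.Coprod.lift_apply_inl,
      map_list_prod, List.map_map, Function.comp_def, FreeGroup.lift_apply_of,
      MonoidHom.id_apply, inv_mul_eq_one] at h1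
    have h2 := congrArg e h1
    rw [he, map_list_prod, List.map_map] at h2
    exact h2.symm
  · have h1 := hf _ (Or.inl (Or.inr ⟨⟨i, r, hr⟩, rfl⟩))
    simp only [inr, Monoid.Coprod.lift_apply_inr] at h1
    rw [hlift, h1, map_one]
  · have h1 := hf _ (Or.inr ⟨⟨t, ht⟩, rfl⟩)
    simp only [inr, Monoid.Coprod.lift_apply_inr] at h1
    have h2 := congrArg e h1
    simp only [map_list_prod, List.map_map, Function.comp_def, map_zpow, map_one] at h2
    simp only [hlift]
    exact h2

end CentralTwist

/-- Reduces many commuting copies to two: copy `i` and the product `r` of all the others. -/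
theorem list_prod_eq_mul {H I : Type*} [Group H] [Fintype I] [DecidableEq I] (x : I → H)
    (hx : ∀ i j, i ≠ j → Commute (x i) (x j)) (i : I) :
    ∃ r, ((Finset.univ : Finset I).toList.map x).prod = x i * r ∧
      ∀ g, (∀ j, j ≠ i → Commute g (x j)) → Commute g r := by
  have hc : ((Finset.univ : Finset I) : Set I).Pairwise (Function.onFun Commute x) :=
    fun i _ j _ hij => hx i j hij
  have hc' : (((Finset.univ : Finset I).erase i : Finset I) : Set I).Pairwise
      (Function.onFun Commute x) := fun i _ j _ hij => hx i j hij
  refine ⟨(Finset.univ.erase i).noncommProd x hc', ?_, fun g hg =>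
    Finset.noncommProd_commute _ _ _ _ fun j hj => hg j (Finset.ne_of_mem_erase hj)⟩
  rw [Finset.mul_noncommProd_erase _ (Finset.mem_univ i) x hc]
  have h := Finset.noncommProd_toFinset (Finset.univ : Finset I).toList x
    (fun i _ j _ hij => hx i j hij) (Finset.nodup_toList _)
  rw [← h]
  simp only [Finset.toList_toFinset]

/-! ### Part: arithmetic of the forms and absorption of twists. -/

namespace TwistIndex

variable {d : ℕ}

/-- A primitive integer vector orthogonal to `(a, b)` has an odd entry, and reduction modulo the
even number `d` preserves parity. -/
theorem exists_dvd_form (hd : Even d) (hd0 : d ≠ 0) (a b : ℤ) :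
    ∃ i : TwistIndex d, (d : ℤ) ∣ i.form a b := by
  obtain ⟨p, q, hpq, h0⟩ : ∃ p q : ℤ, ¬ (Even p ∧ Even q) ∧ p * a + q * b = 0 := by
    by_cases hab : Int.gcd a b = 0
    · obtain ⟨rfl, rfl⟩ := Int.gcd_eq_zero_iff.1 hab
      exact ⟨1, 0, by simp, by simp⟩
    · obtain ⟨a', b', hco, ha, hb⟩ := Int.exists_gcd_one (Nat.pos_of_ne_zero hab)
      refine ⟨b', -a', fun ⟨h1, h2⟩ => ?_, ?_⟩
      · have h3 : (2 : ℤ) ∣ Int.gcd a' b' :=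
          Int.dvd_coe_gcd (even_iff_two_dvd.1 (even_neg.1 h2)) (even_iff_two_dvd.1 h1)
        rw [hco] at h3
        norm_num at h3
      · linear_combination b' * ha - a' * hb
  have hd' : (d : ℤ) ≠ 0 := by exact_mod_cast hd0
  have hdpos : (0 : ℤ) < d := by omega
  have hres (p : ℤ) : ∃ r : Fin d, (d : ℤ) ∣ ((r : ℕ) : ℤ) - p ∧ (Even (r : ℕ) → Even p) := by
    have h1 := Int.emod_nonneg p hd'
    have h2 := Int.emod_lt_of_pos p hdpos
    have h3 : (d : ℤ) ∣ p % d - p := by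
      have := Int.emod_add_mul_ediv p d
      exact ⟨-(p / d), by linarith⟩
    refine ⟨⟨(p % d).toNat, by omega⟩, ?_, fun h => ?_⟩
    · simpa only [Int.toNat_of_nonneg h1] using h3
    · obtain ⟨k, hk⟩ := h3
      obtain ⟨e, he⟩ := hd
      obtain ⟨r, hr⟩ := h
      simp only at hr
      refine ⟨r - e * k, ?_⟩
      have h4 : (p % d) = r + r := by omega
      rw [h4, he] at hk
      push_cast at hk
      linarith
  obtain ⟨r, hr, hr'⟩ := hres p
  obtain ⟨s, hs, hs'⟩ := hres q
  refine ⟨⟨(r, s), fun ⟨h1, h2⟩ => hpq ⟨hr' h1, hs' h2⟩⟩, ?_⟩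
  have : ((r : ℕ) : ℤ) * a + ((s : ℕ) : ℤ) * b = (r - p) * a + (s - q) * b := by linarith
  rw [form, this]
  exact dvd_add (hr.mul_right a) (hs.mul_right b)

/-- Differences of three forms show that `m / gcd(m, d)` divides both `a` and `b`. After division
some form value is divisible by `d`, which supplies the missing factor `gcd(m, d)`. -/
theorem exists_dvd_form_of_congr (hd : Even d) (hd0 : d ≠ 0) {m a b : ℤ}
    (h : ∀ i j : TwistIndex d, m ∣ d * (i.form a b - j.form a b)) :
    ∃ i : TwistIndex d, m ∣ i.form a b := by
  have hd2 : 2 ≤ d := by obtain ⟨e, rfl⟩ := hd; omega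
  have hg : 0 < Int.gcd m d := Int.gcd_pos_of_ne_zero_right _ (by exact_mod_cast hd0)
  obtain ⟨m', d', hco, hm, hd'⟩ := Int.exists_gcd_one hg
  have hg0 : ((Int.gcd m d : ℕ) : ℤ) ≠ 0 := by exact_mod_cast hg.ne'
  have hdvd : ∀ x : ℤ, m ∣ d * x → m' ∣ x := by
    rintro x ⟨y, hy⟩
    have h1 : d' * x = m' * y := by
      apply mul_left_cancel₀ hg0
      calc _ = (d' * (Int.gcd m d : ℤ)) * x := by ring
        _ = (m' * (Int.gcd m d : ℤ)) * y := by rw [← hm, ← hd', hy]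
        _ = _ := by ring
    exact (Int.isCoprime_iff_gcd_eq_one.2 hco).dvd_of_dvd_mul_left ⟨y, h1⟩
  let i₁ : TwistIndex d := ⟨(⟨1, by omega⟩, ⟨0, by omega⟩), by simp⟩
  let i₂ : TwistIndex d := ⟨(⟨0, by omega⟩, ⟨1, by omega⟩), by simp⟩
  let i₃ : TwistIndex d := ⟨(⟨1, by omega⟩, ⟨1, by omega⟩), by simp⟩
  obtain ⟨b', rfl⟩ : m' ∣ b := by simpa [form, i₁, i₃] using hdvd _ (h i₃ i₁)
  obtain ⟨a', rfl⟩ : m' ∣ a := by simpa [form, i₂, i₃] using hdvd _ (h i₃ i₂)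
  obtain ⟨i, hi⟩ := exists_dvd_form hd hd0 a' b'
  refine ⟨i, ?_⟩
  have h1 : i.form (m' * a') (m' * b') = m' * i.form a' b' := by simp only [form]; ring
  rw [h1, hm]
  exact mul_dvd_mul_left m' ((Int.gcd_dvd_right m d).trans hi)

end TwistIndex

/-- The exponent sum of a word weighted by `u`. -/
def weightedSum {X : Type} (w : FreeGroup X) (u : X → ℤ) : ℤ :=
  (FreeGroup.lift (fun t => Multiplicative.ofAdd (u t)) w).toAdd

theorem weightedSum_add {X : Type} (w : FreeGroup X) (u v : X → ℤ) :
    weightedSum w (u + v) = weightedSum w u + weightedSum w v := by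
  have : FreeGroup.lift (fun t => Multiplicative.ofAdd ((u + v) t)) =
      FreeGroup.lift (fun t => Multiplicative.ofAdd (u t)) *
        FreeGroup.lift (fun t => Multiplicative.ofAdd (v t)) := by
    ext t; simp
  rw [weightedSum, this]
  rfl

theorem lift_mul_zpow {X H : Type} [Group H] {ζ : H} (hζ : ζ ∈ Subgroup.center H) (x : X → H)
    (u : X → ℤ) (w : FreeGroup X) :
    FreeGroup.lift (fun t => x t * ζ ^ u t) w = FreeGroup.lift x w * ζ ^ weightedSum w u := by
  let F : FreeGroup X →* H :=
    { toFun := fun w => FreeGroup.lift x w * ζ ^ weightedSum w u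
      map_one' := by simp [weightedSum]
      map_mul' := fun v w => by
        have h := Subgroup.mem_center_iff.1 (zpow_mem hζ (weightedSum v u)) (FreeGroup.lift x w)
        have h' : weightedSum (v * w) u = weightedSum v u + weightedSum w u := by
          simp [weightedSum]
        rw [h', map_mul, zpow_add, mul_assoc, ← mul_assoc (FreeGroup.lift x w), h]
        simp only [mul_assoc] }
  have : FreeGroup.lift (fun t => x t * ζ ^ u t) = F :=
    FreeGroup.ext_hom _ _ fun t => by simp [F, weightedSum]
  rw [this]
  rfl

/-- Multiplying the variables by powers of `ζ` changes the value of `w` by `ζ ^ e` with `e` any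
element of a group `mℤ` of weighted exponent sums. Applying `χ` to the given equations yields `m ∣
χ(h) + d * ℓᵢ` for all `i`, so the differences satisfy the preceding criterion, and at some index
the twist can be undone. -/
theorem absorbsTwists_of_hom {H : Type} [Group H] {ζ : H} (hζ : ζ ∈ Subgroup.center H)
    (χ : H →* Multiplicative ℤ) {d : ℕ} (hd : Even d) (hd0 : d ≠ 0)
    (hχ : χ ζ = Multiplicative.ofAdd (d : ℤ)) : AbsorbsTwists d ζ := by
  intro X _ w x h a b hx
  let E : (X → ℤ) →+ ℤ :=
    { toFun := weightedSum w
      map_zero' := by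
        have := weightedSum_add w 0 0
        rw [add_zero] at this
        linarith
      map_add' := weightedSum_add w }
  obtain ⟨m, hm⟩ := Int.subgroup_cyclic E.range
  have hmem : ∀ y, (∃ u, weightedSum w u = y) ↔ m ∣ y := by
    intro y
    rw [← Int.mem_zmultiples_iff, AddSubgroup.zmultiples_eq_closure, ← hm]
    rfl
  have hE : ∀ i : TwistIndex d, m ∣ (χ h).toAdd + d * i.form a b := by
    intro i
    rw [← hmem]
    refine ⟨fun t => (χ (x i t)).toAdd, ?_⟩
    have h1 := congrArg χ (hx i)
    rw [lift_map_apply, map_mul, map_zpow, hχ] at h1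
    rw [weightedSum]
    simp only [ofAdd_toAdd, h1, toAdd_mul, toAdd_zpow, toAdd_ofAdd, smul_eq_mul]
    ring
  obtain ⟨i, hi⟩ := TwistIndex.exists_dvd_form_of_congr hd hd0 (m := m) (a := a) (b := b)
    fun i j => by
      have := dvd_sub (hE i) (hE j)
      rwa [add_sub_add_left_eq_sub, ← mul_sub] at this
  obtain ⟨u, hu⟩ := (hmem _).2 (dvd_neg.2 hi)
  exact ⟨fun t => x i t * ζ ^ u t, by rw [lift_mul_zpow hζ, hx, hu, mul_assoc, ← zpow_add]; simp⟩

/-! ### Part: permutations commuting with adjacent transpositions. -/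

section Perm

open Equiv

theorem Equiv.Perm.apply_eq_or_of_commute_swap {α : Type*} [DecidableEq α] {p : Perm α} {a b : α}
    (hab : a ≠ b) (h : Commute p (swap a b)) : p a = a ∨ p a = b := by
  by_contra! hne
  have h1 := congrArg (fun q : Perm α => q a) h.eq
  simp only [Perm.mul_apply, swap_apply_left, swap_apply_of_ne_of_ne hne.1 hne.2] at h1
  exact hab (p.injective h1).symm

/-- An odd permutation commuting with all adjacent transpositions except possibly the second one
exchanges `0` and `1` and fixes `2`. -/
theorem Equiv.Perm.apply_of_odd_of_commute_swap {n : ℕ} (hn : 5 ≤ n) {p : Perm (Fin n)}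
    (hp : Perm.sign p = -1)
    (h : ∀ (k : ℕ) (hk : k + 1 < n), k ≠ 1 →
      Commute p (swap ⟨k, by omega⟩ ⟨k + 1, hk⟩)) :
    p ⟨0, by omega⟩ = ⟨1, by omega⟩ ∧ p ⟨1, by omega⟩ = ⟨0, by omega⟩ ∧
      p ⟨2, by omega⟩ = ⟨2, by omega⟩ := by
  have up (k : ℕ) (hk : k + 1 < n) (h1 : k ≠ 1) :
      (p ⟨k, by omega⟩ : ℕ) = k ∨ (p ⟨k, by omega⟩ : ℕ) = k + 1 := by
    have := apply_eq_or_of_commute_swap (by simp) (h k hk h1)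
    simpa [Fin.ext_iff] using this
  have down (k : ℕ) (hk : k + 1 < n) (h1 : k ≠ 1) :
      (p ⟨k + 1, hk⟩ : ℕ) = k + 1 ∨ (p ⟨k + 1, hk⟩ : ℕ) = k := by
    have h' := h k hk h1
    rw [swap_comm] at h'
    have := apply_eq_or_of_commute_swap (by simp) h'
    simpa [Fin.ext_iff] using this
  have inj (k l : ℕ) (hk : k < n) (hl : l < n) (hkl : k ≠ l) :
      (p ⟨k, hk⟩ : ℕ) ≠ p ⟨l, hl⟩ := by
    intro h'
    have := p.injective (Fin.ext h')
    simp at this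
    exact hkl this
  have mid (k : ℕ) (hk : k + 1 < n) (h3 : 3 ≤ k) : (p ⟨k, by omega⟩ : ℕ) = k := by
    obtain ⟨k, rfl⟩ : ∃ l, k = l + 1 := ⟨k - 1, by omega⟩
    have h1 := up (k + 1) hk (by omega)
    have h2 := down k (by omega) (by omega)
    omega
  have h2 : (p ⟨2, by omega⟩ : ℕ) = 2 := by
    have h3 := mid 3 (by omega) le_rfl
    have h4 := up 2 (by omega) (by omega)
    have h5 := inj 2 3 (by omega) (by omega) (by omega)
    omega
  have fix (k : ℕ) (hk : k < n) (h2k : 2 ≤ k) : (p ⟨k, hk⟩ : ℕ) = k := by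
    rcases Nat.lt_or_ge (k + 1) n with h' | h'
    · rcases h2k.eq_or_lt with rfl | h3
      · exact h2
      · exact mid k h' h3
    · obtain ⟨k, rfl⟩ : ∃ l, k = l + 1 := ⟨k - 1, by omega⟩
      have h3 := mid k (by omega) (by omega)
      have h4 := down k hk (by omega)
      have h5 := inj k (k + 1) (by omega) hk (by omega)
      omega
  have h0 := up 0 (by omega) (by omega)
  have h1 := down 0 (by omega) (by omega)
  have h01 := inj 0 1 (by omega) (by omega) (by omega)
  simp only [zero_add] at h0 h1
  rcases h0 with h0 | h0
  · exfalso
    have : p = 1 := by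
      ext ⟨k, hk⟩
      rcases Nat.lt_or_ge k 2 with hk2 | hk2
      · interval_cases k
        · exact h0
        · change _ = 1; omega
      · exact fix k hk hk2
    rw [this, map_one] at hp
    exact absurd hp (by decide)
  · exact ⟨Fin.ext h0, Fin.ext (by change _ = 0; omega), Fin.ext h2⟩

theorem perm_three_not_commute : ∀ p q : Perm (Fin 3), Perm.sign p = -1 → Perm.sign q = -1 →
    p * swap 0 1 = swap 0 1 * p → q * swap 0 1 = swap 0 1 * q →
    p * (swap 0 1 * swap 1 2 * q * (swap 0 1 * swap 1 2)⁻¹) ≠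
      swap 0 1 * swap 1 2 * q * (swap 0 1 * swap 1 2)⁻¹ * p := by
  decide

/-- With four points `(0 1)` and `(2 3)` play symmetric roles, so a second candidate survives and
this size is treated apart. -/
theorem perm_four_odd : ∀ p : Perm (Fin 4), p * swap 0 1 = swap 0 1 * p →
    p * swap 2 3 = swap 2 3 * p → Perm.sign p = -1 → p = swap 0 1 ∨ p = swap 2 3 := by
  decide

theorem perm_four_not_commute {p q : Perm (Fin 4)} (hp : p = swap 0 1 ∨ p = swap 2 3)
    (hq : q = swap 0 1 ∨ q = swap 2 3) :
    p * (swap 0 1 * swap 1 2 * q * (swap 0 1 * swap 1 2)⁻¹) ≠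
      swap 0 1 * swap 1 2 * q * (swap 0 1 * swap 1 2)⁻¹ * p := by
  rcases hp with rfl | rfl <;> rcases hq with rfl | rfl <;> decide

theorem Equiv.swap_braid {α : Type*} [DecidableEq α] {a b c : α} (hab : a ≠ b) (hac : a ≠ c)
    (hbc : b ≠ c) :
    swap a b * swap b c * swap a b = swap b c * swap a b * swap b c := by
  rw [swap_mul_swap_mul_swap hab hac, swap_comm a b, swap_comm b c,
    swap_mul_swap_mul_swap hbc.symm hac.symm, swap_comm]

end Perm

/-! ### Part: braid groups are not strongly verbally closed. -/

namespace BraidGroup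

open Equiv BraidMonoid

variable {n : ℕ}

/-- The adjacent transposition `(i, i + 1)`. -/
def adjSwap (i : Fin (n - 1)) : Perm (Fin n) := swap ⟨i, by omega⟩ ⟨i + 1, by omega⟩

theorem adjSwap_comm {i j : Fin (n - 1)} (h : (i : ℕ) + 2 ≤ j) :
    adjSwap i * adjSwap j = adjSwap j * adjSwap i := by
  refine (Perm.Disjoint.commute (Perm.disjoint_iff_disjoint_support.2 ?_)).eq
  rw [adjSwap, adjSwap, Perm.support_swap (by simp), Perm.support_swap (by simp)]
  simp [Fin.ext_iff]
  omega

theorem adjSwap_braid {i j : Fin (n - 1)} (h : (i : ℕ) + 1 = j) :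
    adjSwap i * adjSwap j * adjSwap i = adjSwap j * adjSwap i * adjSwap j := by
  have hj : (⟨i + 1, by omega⟩ : Fin n) = ⟨j, by omega⟩ := Fin.ext h
  rw [adjSwap, adjSwap, hj]
  exact swap_braid (by simp [Fin.ext_iff]; omega) (by simp [Fin.ext_iff]; omega)
    (by simp [Fin.ext_iff])

/-- The permutation of a braid. -/
def perm (n : ℕ) : BraidGroup n →* Perm (Fin n) :=
  toGroup adjSwap (fun _ _ h => adjSwap_comm h) (fun _ _ h => adjSwap_braid h)

@[simp] theorem perm_σ (i : Fin (n - 1)) : perm n (σ i) = adjSwap i := toGroup_σ _ _ _ i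

/-- Converts odd degree into odd permutation; both sides are homomorphisms that agree on the
generators. -/
theorem sign_perm (g : BraidGroup n) : Perm.sign (perm n g) = (-1) ^ (deg n g).toAdd := by
  have : Perm.sign.comp (perm n) = (zpowersHom ℤˣ (-1)).comp (deg n) := by
    refine PresentedGroup.ext fun i => ?_
    change Perm.sign (perm n (σ i)) = zpowersHom ℤˣ (-1) (deg n (σ i))
    rw [perm_σ, deg_σ, adjSwap, Perm.sign_swap (by simp)]
    rfl
  exact DFunLike.congr_fun this g

/-- Two commuting families of elements that split the generators of the braid group cannot both
consist of braids of odd degree. -/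
theorem not_odd_of_commute (hn : 3 ≤ n) {x y r s : Fin (n - 1) → BraidGroup n}
    (hxr : ∀ k, σ k = x k * r k) (hr : ∀ k l, Commute (x k) (r l))
    (hys : ∀ k, σ k = y k * s k) (hs : ∀ k l, Commute (y k) (s l))
    (hxy : ∀ k l, Commute (x k) (y l))
    (hx : ∀ k l : Fin (n - 1), (k : ℕ) + 2 ≤ l → Commute (x k) (x l))
    (hy : ∀ k l : Fin (n - 1), (k : ℕ) + 2 ≤ l → Commute (y k) (y l))
    (hyb : ∀ k l : Fin (n - 1), (k : ℕ) + 1 = l → y k * y l * y k = y l * y k * y l)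
    (h0x : Odd (deg n (x ⟨0, by omega⟩)).toAdd) (h0y : Odd (deg n (y ⟨0, by omega⟩)).toAdd) :
    False := by
  let o : Fin (n - 1) := ⟨0, by omega⟩
  let t : Fin (n - 1) := ⟨1, by omega⟩
  -- The first element of a family commutes with both factors of `σ k` unless `k = 1`.
  have hcomm : ∀ {u v : Fin (n - 1) → BraidGroup n}, (∀ k, σ k = u k * v k) →
      (∀ k l, Commute (u k) (v l)) →
      (∀ k l : Fin (n - 1), (k : ℕ) + 2 ≤ l → Commute (u k) (u l)) →
      ∀ k : Fin (n - 1), (k : ℕ) ≠ 1 → Commute (perm n (u o)) (adjSwap k) := by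
    intro u v huv hv hu k hk
    rw [← perm_σ]
    refine Commute.map ?_ _
    rw [huv k]
    refine Commute.mul_right ?_ (hv _ _)
    rcases Nat.eq_zero_or_pos (k : ℕ) with h | h
    · rw [show k = o from Fin.ext h]; exact Commute.refl _
    · exact hu _ _ (by simp only [o]; omega)
  have hpc := hcomm hxr hr hx
  have hqc := hcomm hys hs hy
  -- The braid relation gives this for the `y`-factors alone, and the `s`-factors commute with them.
  have hq1 : σ o * σ t * y o = y t * (σ o * σ t) := by
    rw [hys o, hys t]
    calc y o * s o * (y t * s t) * y o = y o * (s o * y t) * (s t * y o) := by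
          simp only [mul_assoc]
      _ = (y o * y t) * (s o * y o) * s t := by
          rw [← (hs t o).eq, ← (hs o t).eq]; simp only [mul_assoc]
      _ = (y o * y t * y o) * (s o * s t) := by rw [← (hs o o).eq]; simp only [mul_assoc]
      _ = y t * y o * (y t * s o) * s t := by rw [hyb o t rfl]; simp only [mul_assoc]
      _ = _ := by rw [(hs t o).eq]; simp only [mul_assoc]
  have hq : perm n (y t) = adjSwap o * adjSwap t * perm n (y o) * (adjSwap o * adjSwap t)⁻¹ := by
    have h := congrArg (perm n) hq1
    simp only [map_mul, perm_σ] at h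
    rw [h, mul_inv_cancel_right]
  have hpq := ((hxy o t).map (perm n)).eq
  rw [hq] at hpq
  have hps : Perm.sign (perm n (x o)) = -1 := by rw [sign_perm, h0x.neg_one_zpow]
  have hqs : Perm.sign (perm n (y o)) = -1 := by rw [sign_perm, h0y.neg_one_zpow]
  generalize perm n (x o) = p at *
  generalize perm n (y o) = q at *
  rcases Nat.lt_or_ge n 5 with h5 | h5
  · obtain rfl | rfl : n = 3 ∨ n = 4 := by omega
    · exact perm_three_not_commute p q hps hqs (hpc o (by simp [o])).eq (hqc o (by simp [o])).eq hpq
    · exact perm_four_not_commute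
        (perm_four_odd p (hpc o (by simp [o])).eq (hpc 2 (by simp)).eq hps)
        (perm_four_odd q (hqc o (by simp [o])).eq (hqc 2 (by simp)).eq hqs) hpq
  · obtain ⟨-, p1, p2⟩ := Perm.apply_of_odd_of_commute_swap h5 hps fun k hk h1 =>
      hpc ⟨k, by omega⟩ h1
    obtain ⟨-, q1, -⟩ := Perm.apply_of_odd_of_commute_swap h5 hqs fun k hk h1 =>
      hqc ⟨k, by omega⟩ h1
    -- The conjugate of `q` sends `2` to `1`, while `p` fixes `2` and sends `1` to `0`; so the two
    -- products differ at `2`.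
    have h := congrArg (fun f : Perm (Fin n) => f ⟨2, by omega⟩) hpq
    have e1 : (adjSwap o * adjSwap t * q * (adjSwap o * adjSwap t)⁻¹) ⟨2, by omega⟩ =
        ⟨1, by omega⟩ := by
      have a1 : (adjSwap o * adjSwap t)⁻¹ ⟨2, by omega⟩ = ⟨1, by omega⟩ := by
        rw [Perm.inv_eq_iff_eq]
        simp [adjSwap, o, t, swap_apply_of_ne_of_ne]
      rw [Perm.mul_apply, a1, Perm.mul_apply, q1]
      simp [adjSwap, o, t, swap_apply_def]
    rw [Perm.mul_apply, e1, Perm.mul_apply _ p, p1, p2, e1] at h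
    simp at h

theorem finite_braidRelators (n : ℕ) : (braidRelators n).Finite := by
  refine Set.Finite.subset ((Set.finite_range fun p : Fin (n - 1) × Fin (n - 1) =>
    FreeGroup.of p.1 * FreeGroup.of p.2 * (FreeGroup.of p.2 * FreeGroup.of p.1)⁻¹).union
    (Set.finite_range fun p : Fin (n - 1) × Fin (n - 1) =>
      FreeGroup.of p.1 * FreeGroup.of p.2 * FreeGroup.of p.1 *
        (FreeGroup.of p.2 * FreeGroup.of p.1 * FreeGroup.of p.2)⁻¹)) ?_
  rintro _ (⟨i, j, h, rfl⟩ | ⟨i, j, h, rfl⟩)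
  · exact Or.inl ⟨(i, j), rfl⟩
  · exact Or.inr ⟨(i, j), rfl⟩

theorem length_delta_pos (hn : 3 ≤ n) : 0 < length (delta (n - 1)) := by
  obtain ⟨t, ht⟩ := gen_dvd_delta (⟨0, by omega⟩ : Fin (n - 1))
  simp [ht]

theorem lift_σ (w : FreeGroup (Fin (n - 1))) :
    FreeGroup.lift (σ : _ → BraidGroup n) w = PresentedGroup.mk _ w :=
  DFunLike.congr_fun (FreeGroup.ext_hom (FreeGroup.lift σ) (PresentedGroup.mk (braidRelators n))
    fun _ => by simp; rfl) w

/-- The braid relation makes the degree `e i` of copy `i` the same on all generators. These degrees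
sum to `1` and are orthogonal to both coordinates of the indices. Exactly one is odd, and reducing
the orthogonality modulo `2` makes both coordinates of its index even. -/
theorem not_isStronglyVerballyClosed (hn : 3 ≤ n) : ¬ IsStronglyVerballyClosed (BraidGroup n) := by
  intro hH
  set D := length (delta (n - 1)) with hD
  have hD0 : 0 < D := length_delta_pos hn
  have hdeg : deg n (fundamental n ^ 2) = Multiplicative.ofAdd (((2 * D : ℕ)) : ℤ) := by
    rw [← ofMonoid_delta_mul_delta, deg_ofMonoid, length_mul, two_mul]
  obtain ⟨z, hz⟩ := PresentedGroup.mk_surjective (braidRelators n) (fundamental n ^ 2)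
  rw [← lift_σ] at hz
  obtain ⟨x, hcomm, hprod, hrel, htw⟩ := hH.exists_commuting_family (d := 2 * D) (by omega)
    sq_fundamental_mem_center
    (absorbsTwists_of_hom sq_fundamental_mem_center (deg n) (even_two_mul D) (by omega) hdeg)
    σ (finite_braidRelators n) (fun r hr => by rw [lift_σ]; exact PresentedGroup.one_of_mem hr) hz
    (T := {(1, 0), (0, 1)}) (by simp)
  have hfar (i) (k l : Fin (n - 1)) (h : (k : ℕ) + 2 ≤ l) : Commute (x i k) (x i l) := by
    have := hrel i _ (Or.inl ⟨k, l, h, rfl⟩)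
    simp only [map_mul, map_inv, FreeGroup.lift_apply_of, mul_inv_eq_one] at this
    exact this
  have hadj (i) (k l : Fin (n - 1)) (h : (k : ℕ) + 1 = l) :
      x i k * x i l * x i k = x i l * x i k * x i l := by
    have := hrel i _ (Or.inr ⟨k, l, h, rfl⟩)
    simpa only [map_mul, map_inv, FreeGroup.lift_apply_of, mul_inv_eq_one] using this
  choose r hr hr' using fun i k => list_prod_eq_mul (fun j => x j k)
    (fun j j' h => hcomm j j' h k k) i
  have hsplit (i k) : σ k = x i k * r i k := by rw [← hr, hprod]
  have hrc (i k l) : Commute (x i k) (r i l) := hr' i l _ fun j hj => hcomm i j hj.symm k l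
  let o : Fin (n - 1) := ⟨0, by omega⟩
  let e (i : TwistIndex (2 * D)) : ℤ := (deg n (x i o)).toAdd
  have hodd (i j) (hij : i ≠ j) (hi : Odd (e i)) (hj : Odd (e j)) : False :=
    not_odd_of_commute hn (hsplit i) (hrc i) (hsplit j) (hrc j) (hcomm i j hij) (hfar i) (hfar j)
      (hadj j) hi hj
  have hdegx (i k) : deg n (x i k) = Multiplicative.ofAdd (e i) := by
    refine adj_closed_eq_univ (p := fun k => deg n (x i k) = Multiplicative.ofAdd (e i))
      (fun k l hkl hk => ?_) (i := o) rfl k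
    have h : x i k * x i l * x i k = x i l * x i k * x i l := by
      rcases hkl with h | h
      · exact hadj i k l h
      · exact (hadj i l k h).symm
    have h1 := congrArg (deg n) h
    have h2 := congrArg Multiplicative.toAdd h1
    simp only [map_mul, toAdd_mul, hk, toAdd_ofAdd] at h2
    apply Multiplicative.toAdd.injective
    rw [toAdd_ofAdd]
    linarith
  have hsum1 : ∑ i, e i = 1 := by
    have h1 := congrArg (deg n) (hprod o)
    rw [map_list_prod, List.map_map, deg_σ] at h1
    have h2 := Finset.prod_map_toList (Finset.univ : Finset (TwistIndex (2 * D)))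
      (deg n ∘ fun i => x i o)
    have h3 := congrArg Multiplicative.toAdd (h2.symm.trans h1)
    simpa [toAdd_prod] using h3
  have hsum0 : ∀ t ∈ ({(1, 0), (0, 1)} : Set (ℤ × ℤ)),
      ∑ i : TwistIndex (2 * D), e i * i.form t.1 t.2 = 0 := by
    intro t ht
    have h1 := congrArg (deg n) (htw t ht)
    have hlift (i) : (deg n (FreeGroup.lift (x i) z)).toAdd = (2 * D : ℕ) * e i := by
      have h1 : FreeGroup.lift (fun k => deg n (x i k)) =
          (zpowGroupHom (e i)).comp ((deg n).comp (FreeGroup.lift σ)) := by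
        refine FreeGroup.ext_hom _ _ fun k => ?_
        simp only [FreeGroup.lift_apply_of, hdegx, MonoidHom.comp_apply, deg_σ,
          zpowGroupHom_apply]
        rw [← ofAdd_zsmul, smul_eq_mul, mul_one]
      rw [lift_map_apply, h1, MonoidHom.comp_apply, MonoidHom.comp_apply, hz, hdeg]
      simp [mul_comm]
    rw [map_list_prod, List.map_map, map_one] at h1
    have h2 := Finset.prod_map_toList (Finset.univ : Finset (TwistIndex (2 * D)))
      (deg n ∘ fun i => FreeGroup.lift (x i) z ^ i.form t.1 t.2)
    have h3 := congrArg Multiplicative.toAdd (h2.symm.trans h1)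
    simp only [toAdd_prod, Function.comp_apply, map_zpow, toAdd_zpow, hlift, toAdd_one,
      smul_eq_mul] at h3
    have h4 : ((2 * D : ℕ) : ℤ) * ∑ i : TwistIndex (2 * D), e i * i.form t.1 t.2 = 0 := by
      rw [← h3, Finset.mul_sum]
      exact Finset.sum_congr rfl fun i _ => by ring
    rcases mul_eq_zero.1 h4 with h | h
    · exact absurd h (by exact_mod_cast (by omega : 2 * D ≠ 0))
    · exact h
  obtain ⟨i₀, hi₀⟩ : ∃ i, Odd (e i) := by
    by_contra! h
    have : Even (∑ i, e i) := Finset.even_sum _ fun i _ => Int.not_odd_iff_even.1 (h i)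
    rw [hsum1] at this
    exact absurd this (by decide)
  have heven : ∀ t ∈ ({(1, 0), (0, 1)} : Set (ℤ × ℤ)), Even (i₀.form t.1 t.2) := by
    intro t ht
    have h1 := hsum0 t ht
    rw [← Finset.add_sum_erase _ _ (Finset.mem_univ i₀)] at h1
    have h2 : Even (∑ i ∈ Finset.univ.erase i₀, e i * i.form t.1 t.2) :=
      Finset.even_sum _ fun i hi => (Int.not_odd_iff_even.1 fun h =>
        hodd i i₀ (Finset.ne_of_mem_erase hi) h hi₀).mul_right _
    have h3 : Even (e i₀ * i₀.form t.1 t.2) := by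
      rw [eq_neg_of_add_eq_zero_left h1]; exact h2.neg
    exact (Int.even_mul.1 h3).resolve_left (Int.not_even_iff_odd.2 hi₀)
  refine i₀.2 ⟨?_, ?_⟩
  · simpa [TwistIndex.form] using heven (1, 0) (by simp)
  · simpa [TwistIndex.form] using heven (0, 1) (by simp)

theorem not_isPureForPower_center (hn : 3 ≤ n) :
    ¬ IsPureForPower 2 (Subgroup.center (BraidGroup n)) := by
  intro h
  obtain ⟨c, hc, hc2⟩ := (h _ sq_fundamental_mem_center).1 ⟨_, rfl⟩
  rw [center_eq hn] at hc
  obtain ⟨k, rfl⟩ := hc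
  have h1 := congrArg (fun g => (deg n g).toAdd) hc2
  rw [← ofMonoid_delta_mul_delta] at h1
  simp only [map_pow, map_zpow, deg_ofMonoid, length_mul, toAdd_pow, toAdd_zpow, toAdd_ofAdd,
    smul_eq_mul, nsmul_eq_mul] at h1
  have h2 := length_delta_pos hn
  push_cast at h1
  have h3 : ((length (delta (n - 1)) : ℕ) : ℤ) * (2 * k) = length (delta (n - 1)) * 1 := by
    linarith
  have h4 := mul_left_cancel₀ (by exact_mod_cast h2.ne') h3
  omega

end BraidGroup

/-! ### Part: the block rotation matrix. -/

section BlockRotation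

open Matrix

/-- `blockDiagonal` indexes by (position, block), whereas the block is the leading digit in `Fin (k
* 2)`; hence the exchange of factors. -/
theorem blockRotation_submatrix (k : ℕ) :
    (blockRotation (k * 2)).submatrix ((Equiv.prodComm (Fin 2) (Fin k)).trans finProdFinEquiv)
      ((Equiv.prodComm (Fin 2) (Fin k)).trans finProdFinEquiv) =
    blockDiagonal fun _ : Fin k => !![0, 1; -1, 0] := by
  ext ⟨a, b⟩ ⟨a', b'⟩
  simp only [submatrix_apply, Equiv.trans_apply, Equiv.prodComm_apply, Prod.swap_prod_mk,
    blockRotation, of_apply, finProdFinEquiv_apply_val, blockDiagonal_apply, Nat.even_iff,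
    Fin.ext_iff]
  fin_cases a <;> fin_cases a' <;> simp <;> split_ifs <;> first | rfl | omega

theorem det_blockRotation {n : ℕ} (hn : Even n) : (blockRotation n).det = 1 := by
  obtain ⟨k, hk⟩ := hn
  obtain rfl : n = k * 2 := by omega
  rw [← det_submatrix_equiv_self ((Equiv.prodComm (Fin 2) (Fin k)).trans finProdFinEquiv),
    blockRotation_submatrix, det_blockDiagonal]
  simp

theorem blockRotation_mul_self {n : ℕ} (hn : Even n) : blockRotation n * blockRotation n = -1 := by
  obtain ⟨k, hk⟩ := hn
  obtain rfl : n = k * 2 := by omega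
  let e := (Equiv.prodComm (Fin 2) (Fin k)).trans finProdFinEquiv
  apply (Matrix.reindex e.symm e.symm).injective
  change (blockRotation (k * 2) * blockRotation (k * 2)).submatrix e e =
    (-1 : Matrix _ _ ℤ).submatrix e e
  rw [← submatrix_mul_equiv _ _ e e e, blockRotation_submatrix, ← blockDiagonal_mul]
  have h1 : (!![0, 1; -1, 0] * !![0, 1; -1, 0] : Matrix (Fin 2) (Fin 2) ℤ) = -1 := by decide
  rw [h1, submatrix_neg, Pi.neg_apply, Pi.neg_apply, submatrix_one_equiv]
  exact (blockDiagonal_neg fun _ : Fin k => (1 : Matrix (Fin 2) (Fin 2) ℤ)).trans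
    (congrArg Neg.neg blockDiagonal_one)

end BlockRotation

/-! ### Part: elementary matrices and indecomposability of the projective group. -/

namespace Matrix.SpecialLinearGroup

open Matrix

variable {ι : Type} [Fintype ι] [DecidableEq ι]

/-- Ordered pairs of distinct indices. -/
abbrev Root (ι : Type) : Type := {p : ι × ι // p.1 ≠ p.2}

/-- The elementary matrix attached to a pair of distinct indices. -/
def elem (α : Root ι) (b : ℤ) : SpecialLinearGroup ι ℤ := transvection α.2 b

theorem elem_coe (α : Root ι) (b : ℤ) :
    (elem α b : Matrix ι ι ℤ) = 1 + single α.1.1 α.1.2 b := transvection_coe _ _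

theorem trace_elem (α : Root ι) (b : ℤ) : trace (elem α b : Matrix ι ι ℤ) = Fintype.card ι := by
  rw [elem_coe, trace_add, trace_one, trace_single_eq_of_ne _ _ _ α.2, add_zero]

theorem commute_single_of_commute_elem {α : Root ι} {a : SpecialLinearGroup ι ℤ}
    (h : Commute a (elem α 1)) : Commute (single α.1.1 α.1.2 (1 : ℤ)) (a : Matrix ι ι ℤ) := by
  have h1 := congrArg Subtype.val h.eq
  simp only [coe_mul, elem_coe, mul_add, add_mul, mul_one, one_mul] at h1
  exact (add_left_cancel h1).symm

theorem elem_commute {α β : Root ι} (h1 : α.1.2 ≠ β.1.1) (h2 : β.1.2 ≠ α.1.1) (a b : ℤ) :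
    Commute (elem α a) (elem β b) := by
  apply Subtype.ext
  simp only [coe_mul, elem_coe, mul_add, add_mul, mul_one, one_mul,
    single_mul_single_of_ne _ _ _ _ h1, single_mul_single_of_ne _ _ _ _ h2]
  abel

theorem coe_eq_one_or_neg_one_of_mem_center [Nonempty ι] {a : SpecialLinearGroup ι ℤ}
    (h : a ∈ Subgroup.center (SpecialLinearGroup ι ℤ)) :
    (a : Matrix ι ι ℤ) = 1 ∨ (a : Matrix ι ι ℤ) = -1 := by
  obtain ⟨r, hr, hra⟩ := mem_center_iff.1 h
  rcases Int.isUnit_iff.1 (IsUnit.of_pow_eq_one hr Fintype.card_ne_zero) with rfl | rfl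
  · left; rw [← hra]; simp
  · right; rw [← hra]; simp

theorem mem_center_of_commute_elem {a : SpecialLinearGroup ι ℤ}
    (h : ∀ α : Root ι, Commute a (elem α 1)) : a ∈ Subgroup.center (SpecialLinearGroup ι ℤ) := by
  obtain ⟨r, hr⟩ := mem_range_scalar_of_commute_single (M := (a : Matrix ι ι ℤ))
    fun i j hij => commute_single_of_commute_elem (h ⟨(i, j), hij⟩)
  refine mem_center_iff.2 ⟨r, ?_, hr⟩
  have := a.2
  rwa [← hr, scalar_apply, det_diagonal, Finset.prod_const, Finset.card_univ] at this

theorem mem_center_of_coe_eq_neg_one {a : SpecialLinearGroup ι ℤ} (h : (a : Matrix ι ι ℤ) = -1) :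
    a ∈ Subgroup.center (SpecialLinearGroup ι ℤ) := by
  rw [Subgroup.mem_center_iff]
  intro g
  have : ((g * a : SpecialLinearGroup ι ℤ) : Matrix ι ι ℤ) = (a * g : SpecialLinearGroup ι ℤ) := by
    rw [coe_mul, coe_mul, h, mul_neg, neg_mul, mul_one, one_mul]
  exact Subtype.ext this

/-- The projection to the projective special linear group. -/
abbrev proj (ι : Type) [Fintype ι] [DecidableEq ι] :
    SpecialLinearGroup ι ℤ →* ProjectiveSpecialLinearGroup ι ℤ := QuotientGroup.mk' _

theorem proj_eq_one {a : SpecialLinearGroup ι ℤ} :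
    proj ι a = 1 ↔ a ∈ Subgroup.center (SpecialLinearGroup ι ℤ) :=
  QuotientGroup.eq_one_iff a

theorem proj_eq_proj [Nonempty ι] {a b : SpecialLinearGroup ι ℤ} (h : proj ι a = proj ι b) :
    (a : Matrix ι ι ℤ) = b ∨ (a : Matrix ι ι ℤ) = -b := by
  have h1 : b⁻¹ * a ∈ Subgroup.center _ := QuotientGroup.eq.1 h.symm
  have h2 : a = b * (b⁻¹ * a) := by group
  rcases coe_eq_one_or_neg_one_of_mem_center h1 with h3 | h3
  · left; rw [h2, coe_mul, h3, mul_one]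
  · right; rw [h2, coe_mul, h3, mul_neg, mul_one]

/-- Commutation of a transvection with an element modulo the centre is genuine commutation. -/
theorem commute_elem_of_proj {α : Root ι} {b : ℤ} {a : SpecialLinearGroup ι ℤ}
    (h : Commute (proj ι a) (proj ι (elem α b))) : Commute a (elem α b) := by
  have : Nonempty ι := ⟨α.1.1⟩
  have h1 : proj ι (a * elem α b * a⁻¹) = proj ι (elem α b) := by
    rw [map_mul, map_mul, h.eq, map_inv, mul_inv_cancel_right]
  rcases proj_eq_proj h1 with h2 | h2
  · exact mul_inv_eq_iff_eq_mul.1 (Subtype.ext h2)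
  -- A conjugate of a transvection has trace `Fintype.card ι > 0`, so it is not the negative of a
  -- transvection.
  · exfalso
    have h3 := congrArg trace h2
    rw [trace_neg, coe_mul, trace_mul_comm, ← coe_mul, ← mul_assoc, inv_mul_cancel, one_mul,
      trace_elem] at h3
    have := Fintype.card_pos (α := ι)
    omega

/-- The commutations kill all off-diagonal entries except the one at `α` and equalize the diagonal.
Invertibility over `ℤ` makes the diagonal entry `±1`, and the sign is central. -/
theorem exists_eq_of_commute_elem {α : Root ι} {a : SpecialLinearGroup ι ℤ}
    (h : ∀ β : Root ι, β.1.1 ≠ α.1.2 → β.1.2 ≠ α.1.1 → Commute a (elem β 1)) :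
    ∃ μ : ℤ, proj ι a = proj ι (elem α μ) := by
  obtain ⟨⟨p, q⟩, hpq⟩ := α
  simp only at hpq h
  have hs (k l : ι) (hkl : k ≠ l) (hk : k ≠ q) (hl : l ≠ p) :
      Commute (single k l (1 : ℤ)) (a : Matrix ι ι ℤ) :=
    commute_single_of_commute_elem (h ⟨(k, l), hkl⟩ hk hl)
  have hpq' := hs p q hpq hpq hpq.symm
  have hmat : (a : Matrix ι ι ℤ) = a p p • (1 : Matrix ι ι ℤ) + single p q (a p q) := by
    ext x y
    rw [add_apply, smul_apply, smul_eq_mul]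
    have hsame : a x x = a p p := by
      rcases eq_or_ne x p with rfl | hx
      · rfl
      rcases eq_or_ne x q with rfl | hx'
      · exact (diag_eq_of_commute_single hpq').symm
      · exact (diag_eq_of_commute_single (hs p x hx.symm hpq hx)).symm
    have hoff (hxy : x ≠ y) (hne : ¬ (x = p ∧ y = q)) : a x y = 0 := by
      rcases eq_or_ne x p with rfl | hx
      · have hy : y ≠ q := fun h => hne ⟨rfl, h⟩
        exact col_eq_zero_of_commute_single (hs y q hy hy hpq.symm) hxy
      rcases eq_or_ne x q with rfl | hx'
      · exact row_eq_zero_of_commute_single hpq' hxy.symm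
      · exact row_eq_zero_of_commute_single (hs p x hx.symm hpq hx) hxy.symm
    rcases eq_or_ne x y with rfl | hxy
    · have : ¬ (p = x ∧ q = x) := fun ⟨h1, h2⟩ => hpq (h1.trans h2.symm)
      rw [one_apply_eq, single_apply_of_ne _ _ _ _ _ this, hsame, mul_one, add_zero]
    · by_cases hc : x = p ∧ y = q
      · obtain ⟨rfl, rfl⟩ := hc
        rw [one_apply_ne hxy, single_apply_same, mul_zero, zero_add]
      · have : ¬ (p = x ∧ q = y) := fun ⟨h1, h2⟩ => hc ⟨h1.symm, h2.symm⟩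
        rw [one_apply_ne hxy, single_apply_of_ne _ _ _ _ _ this, hoff hxy hc, mul_zero, add_zero]
  have hunit : IsUnit (a p p) := by
    have h1 : ((a⁻¹ * a : SpecialLinearGroup ι ℤ) : Matrix ι ι ℤ) p p = 1 := by simp
    rw [coe_mul, hmat, mul_add, add_apply, mul_smul_comm, mul_one] at h1
    rw [mul_single_apply_of_ne _ _ _ _ _ hpq] at h1
    rw [add_zero, smul_apply, smul_eq_mul] at h1
    exact .of_mul_eq_one _ h1
  rcases Int.isUnit_iff.1 hunit with h1 | h1
  · refine ⟨a p q, ?_⟩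
    congr 1
    apply Subtype.ext
    change (a : Matrix ι ι ℤ) = (elem _ _ : SpecialLinearGroup ι ℤ)
    rw [elem_coe]
    nth_rw 1 [hmat]
    rw [h1, one_smul]
  · refine ⟨-a p q, ?_⟩
    refine QuotientGroup.eq.2 (mem_center_of_coe_eq_neg_one ?_)
    have h2 : (a : Matrix ι ι ℤ) = -(elem ⟨(p, q), hpq⟩ (-a p q) : SpecialLinearGroup ι ℤ) := by
      rw [elem_coe]
      nth_rw 1 [hmat]
      rw [h1, neg_add, neg_smul, one_smul, ← single_neg, neg_neg]
    have h3 : ((a⁻¹ * a : SpecialLinearGroup ι ℤ) : Matrix ι ι ℤ) = 1 := by simp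
    rw [coe_mul, h2, mul_neg] at h3
    rw [coe_mul, ← h3, neg_neg]

theorem mul_eq_zero_of_commute_elem {α β : Root ι} (h : α.1.2 = β.1.1) {a b : ℤ}
    (hc : Commute (elem α a) (elem β b)) : a * b = 0 := by
  obtain ⟨⟨p, q⟩, hpq⟩ := α
  obtain ⟨⟨q', r⟩, hqr⟩ := β
  obtain rfl : q = q' := h
  simp only at hpq hqr
  have h1 := congrArg Subtype.val hc.eq
  simp only [coe_mul, elem_coe, mul_add, add_mul, mul_one, one_mul, single_mul_single_same] at h1
  have h2 := congrFun (congrFun h1 p) r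
  have h3 : (single q r b * single p q a : Matrix ι ι ℤ) p r = 0 :=
    single_mul_apply_of_ne _ _ _ _ _ hpq _
  simp only [add_apply, h3, single_apply_same, add_zero] at h2
  linarith

/-- If the elementary matrices are split modulo the centre into two commuting factors, then one of
the factors is always trivial. -/
theorem trivial_or_trivial_of_split {x y : Root ι → ProjectiveSpecialLinearGroup ι ℤ}
    (hxy : ∀ α β, Commute (x α) (y β)) (hmul : ∀ α, x α * y α = proj ι (elem α 1))
    (hx : ∀ α β : Root ι, α.1.2 ≠ β.1.1 → β.1.2 ≠ α.1.1 → Commute (x α) (x β)) :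
    (∀ α, x α = 1) ∨ ∀ α, y α = 1 := by
  have hμ : ∀ α, ∃ μ : ℤ, x α = proj ι (elem α μ) := by
    intro α
    obtain ⟨a, ha⟩ := QuotientGroup.mk'_surjective _ (x α)
    rw [← ha]
    refine exists_eq_of_commute_elem fun β h1 h2 => commute_elem_of_proj ?_
    rw [← hmul]
    change Commute (QuotientGroup.mk' _ a) _
    rw [ha]
    exact (hx α β h1.symm h2).mul_right (hxy α β)
  choose μ hμ using hμ
  have hy : ∀ α, y α = proj ι (elem α (1 - μ α)) := by
    intro α
    have h1 := hmul α
    have h2 : elem α 1 = elem α (μ α) * elem α (1 - μ α) := by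
      rw [elem, elem, elem, ← transvection_add, add_sub_cancel]
    rw [hμ, h2, map_mul] at h1
    exact mul_left_cancel h1
  -- For composable roots the commutation of `x α` with `y β` reads `μ α * (1 - μ β) = 0`.
  have hstep : ∀ α β : Root ι, α.1.2 = β.1.1 → μ α ≠ 0 → μ β = 1 := by
    intro α β h h0
    have h1 := hxy α β
    rw [hμ, hy] at h1
    have h2 := mul_eq_zero_of_commute_elem h (commute_elem_of_proj h1)
    have h3 := (mul_eq_zero.1 h2).resolve_left h0
    linarith
  by_cases h : ∀ α, μ α = 0
  · left
    intro α
    rw [hμ, h, elem, transvection_coeff_zero, map_one]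
  · right
    push Not at h
    obtain ⟨α, hα⟩ := h
    have hall : ∀ β, μ β = 1 := by
      intro β
      -- Every root is reached from `α` directly or through the root joining the end of `α` to the
      -- start of `β`.
      by_cases hc : α.1.2 = β.1.1
      · exact hstep α β hc hα
      · have h1 := hstep α ⟨(α.1.2, β.1.1), hc⟩ rfl hα
        exact hstep ⟨(α.1.2, β.1.1), hc⟩ β rfl (by rw [h1]; exact one_ne_zero)
    intro β
    rw [hy, hall, sub_self, elem, transvection_coeff_zero, map_one]

theorem eq_one_of_commute_proj_elem {g : ProjectiveSpecialLinearGroup ι ℤ}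
    (h : ∀ α : Root ι, Commute g (proj ι (elem α 1))) : g = 1 := by
  obtain ⟨a, rfl⟩ := QuotientGroup.mk'_surjective _ g
  exact proj_eq_one.2 (mem_center_of_commute_elem fun α => commute_elem_of_proj (h α))

theorem proj_elem_ne_one (α : Root ι) : proj ι (elem α 1) ≠ 1 := by
  rw [Ne, proj_eq_one, elem, transvection_mem_center_iff]
  exact one_ne_zero

/-- Splitting the elementary matrices along `A` and `B` makes one family of components trivial; the
corresponding factor then centralizes all elementary matrices, hence is trivial. -/
theorem isDirectlyIndecomposable [Nontrivial ι] :
    IsDirectlyIndecomposable (ProjectiveSpecialLinearGroup ι ℤ) := by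
  obtain ⟨p, q, hpq⟩ := exists_pair_ne ι
  refine ⟨⟨_, _, proj_elem_ne_one ⟨(p, q), hpq⟩⟩, fun A B hA hB hinf hsup => ?_⟩
  have hAB (a b) (ha : a ∈ A) (hb : b ∈ B) : Commute a b :=
    Subgroup.commute_of_normal_of_disjoint A B hA hB (disjoint_iff.2 hinf) a b ha hb
  have hdec : ∀ α : Root ι, ∃ a ∈ A, ∃ b ∈ B, a * b = proj ι (elem α 1) := fun α =>
    Subgroup.mem_sup_of_normal_right.1 (hsup ▸ trivial)
  choose x hx y hy hxy using hdec
  have key := trivial_or_trivial_of_split (x := x) (y := y) (fun α β => hAB _ _ (hx α) (hy β)) hxy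
    (fun α β h1 h2 => by
      have hc : Commute (x α * y α) (x β * y β) := by
        rw [hxy, hxy]; exact (elem_commute h1 h2 1 1).map (proj ι)
      have e1 := (hAB _ _ (hx β) (hy α)).eq
      have e2 := (hAB _ _ (hx α) (hy β)).eq
      -- Commuting products have commuting components: the commutator of the `A`-parts equals an
      -- element of `B`, so it lies in `A ⊓ B = ⊥`.
      have hc1 : x α * x β * (y α * y β) = x β * x α * (y β * y α) := by
        calc _ = x α * (x β * y α) * y β := by simp only [mul_assoc]
          _ = x α * y α * (x β * y β) := by rw [e1]; simp only [mul_assoc]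
          _ = x β * (y β * x α) * y α := by rw [hc.eq]; simp only [mul_assoc]
          _ = _ := by rw [← e2]; simp only [mul_assoc]
      have hc2 : (x β * x α)⁻¹ * (x α * x β) = y β * y α * (y α * y β)⁻¹ := by
        rw [inv_mul_eq_iff_eq_mul, ← mul_assoc, eq_mul_inv_iff_mul_eq, hc1]
      have hc3 : (x β * x α)⁻¹ * (x α * x β) ∈ A ⊓ B := Subgroup.mem_inf.2
        ⟨A.mul_mem (A.inv_mem (A.mul_mem (hx _) (hx _))) (A.mul_mem (hx _) (hx _)),
          hc2 ▸ B.mul_mem (B.mul_mem (hy _) (hy _)) (B.inv_mem (B.mul_mem (hy _) (hy _)))⟩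
      rw [hinf, Subgroup.mem_bot, inv_mul_eq_one] at hc3
      exact hc3.symm)
  rcases key with h | h
  · left
    rw [Subgroup.eq_bot_iff_forall]
    intro a ha
    refine eq_one_of_commute_proj_elem fun α => ?_
    rw [← hxy, h, one_mul]
    exact hAB _ _ ha (hy α)
  · right
    rw [Subgroup.eq_bot_iff_forall]
    intro b hb
    refine eq_one_of_commute_proj_elem fun α => ?_
    rw [← hxy, h, mul_one]
    exact (hAB _ _ (hx α) hb).symm

end Matrix.SpecialLinearGroup

/-! ### Part: special linear groups are not strongly verbally closed. -/

theorem absorbsTwists_of_sq_eq_one {H : Type} [Group H] {ζ : H} (hζ : ζ ^ 2 = 1) :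
    AbsorbsTwists 2 ζ := by
  intro X _ w x h a b hx
  obtain ⟨i, c, hc⟩ := TwistIndex.exists_dvd_form (d := 2) even_two two_ne_zero a b
  refine ⟨x i, ?_⟩
  have : ζ ^ i.form a b = 1 := by
    rw [hc, zpow_mul, Nat.cast_ofNat, zpow_ofNat, hζ, one_zpow]
  rw [hx, this, mul_one]

theorem list_prod_zpow_eq {H I : Type*} [Group H] [Fintype I] [DecidableEq I] (ζ : H) (i₀ : I)
    {y : I → H} (hy : ∀ i, i ≠ i₀ → y i = 1) (hy₀ : y i₀ = ζ) (f : I → ℤ) :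
    ((Finset.univ : Finset I).toList.map fun i => y i ^ f i).prod = ζ ^ f i₀ := by
  rw [List.prod_map_eq_pow_single i₀ _ fun i hi _ => by rw [hy i hi, one_zpow],
    List.count_eq_one_of_mem (Finset.nodup_toList _) (Finset.mem_toList.2 (Finset.mem_univ i₀)),
    pow_one, hy₀]

theorem zpow_eq_self_of_odd {H : Type*} [Group H] {ζ : H} (hζ : ζ ^ 2 = 1) {k : ℤ} (hk : Odd k) :
    ζ ^ k = ζ := by
  obtain ⟨l, rfl⟩ := hk
  rw [zpow_add, zpow_mul, zpow_ofNat, hζ, one_zpow, one_mul, zpow_one]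

namespace Matrix.SpecialLinearGroup

open Matrix

variable {ι : Type} [Fintype ι] [DecidableEq ι]

theorem sq_eq_one_of_mem_center [Nonempty ι] {a : SpecialLinearGroup ι ℤ}
    (h : a ∈ Subgroup.center (SpecialLinearGroup ι ℤ)) : a ^ 2 = 1 := by
  apply Subtype.ext
  change ((a ^ 2 : SpecialLinearGroup ι ℤ) : Matrix ι ι ℤ) = 1
  rw [sq, coe_mul]
  rcases coe_eq_one_or_neg_one_of_mem_center h with h | h <;> rw [h] <;> simp

theorem ne_one_of_coe_eq_neg_one [Nonempty ι] {a : SpecialLinearGroup ι ℤ}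
    (h : (a : Matrix ι ι ℤ) = -1) : a ≠ 1 := by
  rintro rfl
  obtain ⟨i⟩ := ‹Nonempty ι›
  have := congrFun (congrFun h i) i
  simp at this

/-- Modulo the centre one copy `i₀` carries all elementary matrices, so the other copies, commuting
with it, are central. Central elements square to `1`; hence the copies of `J ^ 2` are trivial except
at `i₀`, where the value is `J ^ 2 = -1`, and the twist equations make both coordinates of `i₀`
even. -/
theorem not_isStronglyVerballyClosed [Nontrivial ι] {J : SpecialLinearGroup ι ℤ}
    (hJ : ((J ^ 2 : SpecialLinearGroup ι ℤ) : Matrix ι ι ℤ) = -1) :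
    ¬ IsStronglyVerballyClosed (SpecialLinearGroup ι ℤ) := by
  intro hH
  have hcen := mem_center_of_coe_eq_neg_one hJ
  have hζ2 := sq_eq_one_of_mem_center hcen
  have hζ1 := ne_one_of_coe_eq_neg_one hJ
  let rel (p : Root ι × Root ι) : FreeGroup (Root ι ⊕ Unit) :=
    FreeGroup.of (Sum.inl p.1) * FreeGroup.of (Sum.inl p.2) *
      (FreeGroup.of (Sum.inl p.2) * FreeGroup.of (Sum.inl p.1))⁻¹
  let R : Set (FreeGroup (Root ι ⊕ Unit)) :=
    rel '' {p | p.1.1.2 ≠ p.2.1.1 ∧ p.2.1.2 ≠ p.1.1.1}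
  obtain ⟨x, hcomm, hprod, hrel, htw⟩ := hH.exists_commuting_family le_rfl hcen
    (absorbsTwists_of_sq_eq_one hζ2) (Sum.elim (fun α : Root ι => elem α 1) fun _ : Unit => J)
    (R := R) (Set.toFinite _) (by
      rintro _ ⟨⟨α, β⟩, ⟨h1, h2⟩, rfl⟩
      simpa [rel, mul_inv_eq_one, -_root_.mul_inv_rev] using (elem_commute h1 h2 1 1).eq)
    -- Writing `-1` as the square of an extra variable for `J` makes central factors disappear.
    (z := FreeGroup.of (Sum.inr ()) ^ 2) (by simp)
    (T := {(1, 0), (0, 1)}) (by simp)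
  have hxx (i) (α β : Root ι) (h1 : α.1.2 ≠ β.1.1) (h2 : β.1.2 ≠ α.1.1) :
      Commute (x i (Sum.inl α)) (x i (Sum.inl β)) := by
    have := hrel i _ ⟨(α, β), ⟨h1, h2⟩, rfl⟩
    simp only [rel, map_mul, map_inv, FreeGroup.lift_apply_of, mul_inv_eq_one] at this
    exact this
  choose r hr hr' using fun i k => list_prod_eq_mul (fun j => x j k)
    (fun j j' h => hcomm j j' h k k) i
  have hsplit (i k) : _ = x i k * r i k := (hprod k).symm.trans (hr i k)
  have hrc (i k l) : Commute (x i k) (r i l) := hr' i l _ fun j hj => hcomm i j hj.symm k l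
  have hdich (i) : (∀ α : Root ι, proj ι (x i (Sum.inl α)) = 1) ∨
      ∀ α : Root ι, proj ι (r i (Sum.inl α)) = 1 := by
    refine trivial_or_trivial_of_split (fun α β => (hrc i _ _).map (proj ι)) (fun α => ?_)
      fun α β h1 h2 => (hxx i α β h1 h2).map (proj ι)
    rw [← map_mul, ← hsplit]
    rfl
  obtain ⟨i₀, hi₀⟩ : ∃ i, ∀ α : Root ι, proj ι (r i (Sum.inl α)) = 1 := by
    by_contra! h
    obtain ⟨p, q, hpq⟩ := exists_pair_ne ι
    apply proj_elem_ne_one (⟨(p, q), hpq⟩ : Root ι)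
    have h1 := congrArg (proj ι) (hprod (Sum.inl ⟨(p, q), hpq⟩))
    rw [map_list_prod, List.map_map] at h1
    refine h1.symm.trans (List.prod_eq_one fun g hg => ?_)
    obtain ⟨i, -, rfl⟩ := List.mem_map.1 hg
    refine (hdich i).resolve_right (fun h' => ?_) _
    obtain ⟨α, hα⟩ := h i
    exact hα (h' α)
  have hx₀ (α : Root ι) : proj ι (x i₀ (Sum.inl α)) = proj ι (elem α 1) := by
    have h1 := congrArg (proj ι) (hsplit i₀ (Sum.inl α))
    rw [map_mul, hi₀, mul_one] at h1
    exact h1.symm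
  have hcentral {g : SpecialLinearGroup ι ℤ}
      (hg : ∀ α : Root ι, Commute g (x i₀ (Sum.inl α))) : g ∈ Subgroup.center _ := by
    refine mem_center_of_commute_elem fun α => commute_elem_of_proj ?_
    rw [← hx₀]
    exact (hg α).map (proj ι)
  have hone (i) (hi : i ≠ i₀) : FreeGroup.lift (x i) (FreeGroup.of (Sum.inr ()) ^ 2) = 1 := by
    rw [map_pow, FreeGroup.lift_apply_of]
    exact sq_eq_one_of_mem_center (hcentral fun α => hcomm i i₀ hi _ _)
  have hζ : FreeGroup.lift (x i₀) (FreeGroup.of (Sum.inr ()) ^ 2) = J ^ 2 := by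
    rw [map_pow, FreeGroup.lift_apply_of]
    have h1 : J = x i₀ (Sum.inr ()) * r i₀ (Sum.inr ()) := hsplit i₀ (Sum.inr ())
    have h2 : r i₀ (Sum.inr ()) ^ 2 = 1 :=
      sq_eq_one_of_mem_center (hcentral fun α => (hrc i₀ _ _).symm)
    rw [h1, (hrc i₀ _ _).mul_pow, h2, mul_one]
  have heven : ∀ t ∈ ({(1, 0), (0, 1)} : Set (ℤ × ℤ)), Even (i₀.form t.1 t.2) := by
    intro t ht
    have h1 := htw t ht
    rw [list_prod_zpow_eq (J ^ 2) i₀ hone hζ fun i => i.form t.1 t.2] at h1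
    by_contra hodd
    exact hζ1 ((zpow_eq_self_of_odd hζ2 (Int.not_even_iff_odd.1 hodd)).symm.trans h1)
  refine i₀.2 ⟨?_, ?_⟩
  · simpa [TwistIndex.form] using heven (1, 0) (by simp)
  · simpa [TwistIndex.form] using heven (0, 1) (by simp)

theorem center_eq_zpowers [Nonempty ι] {a : SpecialLinearGroup ι ℤ}
    (h : (a : Matrix ι ι ℤ) = -1) :
    Subgroup.center (SpecialLinearGroup ι ℤ) = Subgroup.zpowers a := by
  refine le_antisymm (fun g hg => ?_) (by simpa using mem_center_of_coe_eq_neg_one h)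
  rcases coe_eq_one_or_neg_one_of_mem_center hg with h' | h'
  · rw [show g = 1 from Subtype.ext h']
    exact one_mem _
  · rw [show g = a from Subtype.ext (h'.trans h.symm)]
    exact Subgroup.mem_zpowers a

theorem not_isPureForPower_center [Nonempty ι] {J : SpecialLinearGroup ι ℤ}
    (hJ : ((J ^ 2 : SpecialLinearGroup ι ℤ) : Matrix ι ι ℤ) = -1) :
    ¬ IsPureForPower 2 (Subgroup.center (SpecialLinearGroup ι ℤ)) := by
  intro h
  obtain ⟨c, hc, hc2⟩ := (h _ (mem_center_of_coe_eq_neg_one hJ)).1 ⟨J, rfl⟩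
  rw [sq_eq_one_of_mem_center hc] at hc2
  exact ne_one_of_coe_eq_neg_one hJ hc2.symm

end Matrix.SpecialLinearGroup

theorem IsPrimePure.isPureForPower {A : Type*} [Group A] {p : ℕ} {B : Subgroup A}
    (h : IsPrimePure p B) : IsPureForPower p B := by
  simpa using h 1 one_pos

theorem mainTheorem4 :
    (∀ n : ℕ, (¬ ∀ a b : BraidGroup n, a * b = b * a) →
      ¬ IsStronglyVerballyClosed (BraidGroup n) ∧
      ¬ IsPrimePure 2 (Subgroup.center (BraidGroup n)) ∧
      ¬ IsPureForPower 2 (Subgroup.center (BraidGroup n)) ∧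
      Subgroup.center (BraidGroup n) = Subgroup.zpowers (BraidGroup.fundamental n ^ 2) ∧
      (∀ g : BraidGroup n, IsOfFinOrder g → g = 1)) ∧
    (∀ n : ℕ, Even n → 0 < n →
      ¬ IsStronglyVerballyClosed (Matrix.SpecialLinearGroup (Fin n) ℤ) ∧
      ¬ IsPrimePure 2 (Subgroup.center (Matrix.SpecialLinearGroup (Fin n) ℤ)) ∧
      ¬ IsPureForPower 2 (Subgroup.center (Matrix.SpecialLinearGroup (Fin n) ℤ)) ∧
      (∃ J : Matrix.SpecialLinearGroup (Fin n) ℤ,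
        (J : Matrix (Fin n) (Fin n) ℤ) = blockRotation n ∧
        ((J ^ 2 : Matrix.SpecialLinearGroup (Fin n) ℤ) : Matrix (Fin n) (Fin n) ℤ) = -1 ∧
        Subgroup.center (Matrix.SpecialLinearGroup (Fin n) ℤ) = Subgroup.zpowers (J ^ 2)) ∧
      IsDirectlyIndecomposable (Matrix.ProjectiveSpecialLinearGroup (Fin n) ℤ)) := by
  refine ⟨fun n h => ?_, fun n hn hn0 => ?_⟩
  · have hn := BraidGroup.three_le_of_not_comm h
    have hpure := BraidGroup.not_isPureForPower_center hn
    exact ⟨BraidGroup.not_isStronglyVerballyClosed hn, fun h' => hpure h'.isPureForPower, hpure,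
      BraidGroup.center_eq hn, fun g hg => BraidGroup.eq_one_of_isOfFinOrder hg⟩
  · have : Nontrivial (Fin n) := Fin.nontrivial_iff_two_le.2 (by obtain ⟨k, rfl⟩ := hn; omega)
    let J : Matrix.SpecialLinearGroup (Fin n) ℤ := ⟨blockRotation n, det_blockRotation hn⟩
    have hJ : ((J ^ 2 : Matrix.SpecialLinearGroup (Fin n) ℤ) : Matrix (Fin n) (Fin n) ℤ) = -1 := by
      rw [sq, Matrix.SpecialLinearGroup.coe_mul]
      exact blockRotation_mul_self hn
    have hpure := Matrix.SpecialLinearGroup.not_isPureForPower_center hJ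
    exact ⟨Matrix.SpecialLinearGroup.not_isStronglyVerballyClosed hJ,
      fun h' => hpure h'.isPureForPower, hpure,
      ⟨J, rfl, hJ, Matrix.SpecialLinearGroup.center_eq_zpowers hJ⟩,
      Matrix.SpecialLinearGroup.isDirectlyIndecomposable⟩
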